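/- \textbf{Theorem (Stochastic Sufficiency is Decidable in Explicit State).} A stochastic decision problem $\mathcal D_S=(A,X_1,\dots,X_n,U,P)$ consists of a finite action set $A$, finite coordinate spaces $X_1,\dots,X_n$ with state space $S=X_1\times\cdots\times X_n$, a rational-valued utility $U:A\times S\to\mathbb Q$, and a probability distribution $P$ on $S$ with rational probabilities. For $s\in S$ let $\mathrm{Opt}(s)=\arg\max_{a\in A}U(a,s)$. For $I\subseteq\{1,\dots,n\}$, write $s_I=(s_i)_{i\in I}$, and for every $\alpha$ with $P(S_I=\alpha)>0$ let \[ \mathrm{Opt}^{\mathrm{stoch}}_I(\alpha)=\arg\max_{a\in A}\ \mathbb E_{S\sim P}\bigl[U(a,S)\mid S_I=\alpha\bigr]. \] The set $I$ is stochastically sufficient if $\mathrm{Opt}^{\mathrm{stoch}}_I(s_I)=\mathrm{Opt}(s)$ for all $s\in S$. At states $s$ with $P(S_I=s_I)=0$, where $\mathrm{Opt}^{\mathrm{stoch}}_I(s_I)$ is not defined by the formula above, fix any one of the following three conventions: nothing is required at $s$; the requirement counts as violated at $s$; or $\mathrm{Opt}^{\mathrm{stoch}}_I(s_I)=A$. STOCHASTIC-SUFFICIENCY-CHECK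 is the problem: given $\mathcal D_S$ and $I\subseteq\{1,\dots,n\}$, is $I$ stochastically sufficient? In the explicit-state encoding the input is the string listing $|A|$, the sizes $|X_1|,\dots,|X_n|$, the indicator vector of $I$, and a table with one row for each state $s\in S$ containing the coordinates of $s$, the probability $P(s)$ and the utilities $U(a,s)$ for all $a\in A$; all numbers are written in binary, rational numbers as fractions in lowest terms. Then, under each of the three conventions, STOCHASTIC-SUFFICIENCY-CHECK under the explicit-state encoding is decidable in polynomial time: there are a Turing machine and a polynomial $p$ such that on the encoding, of length $\ell$, of any input $(\mathcal D_S,I)$ the machine halts with the correct answer after at most $p(\ell)$ steps. -/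

import Mathlib

/-- A stochastic decision problem `(A, X₁, …, Xₙ, U, P)` with finite data: the actions are
`Fin numActions`, the `i`-th coordinate space is `Fin (card i)`, utilities and probabilities are
rational, and `P` is a probability distribution on the product of the coordinate spaces. -/
structure StochasticDecisionProblem where
  numActions : ℕ
  n : ℕ
  card : Fin n → ℕ
  U : Fin numActions → ((i : Fin n) → Fin (card i)) → ℚ
  P : ((i : Fin n) → Fin (card i)) → ℚ
  P_nonneg : ∀ s, 0 ≤ P s
  P_sum : ∑ s, P s = 1

/-- What the requirement "the conditional optimizer at `s_I` equals the optimizer at `s`" means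
at a state `s` for which the event `S_I = s_I` has probability zero, so that conditioning on it is
not defined:
* `ignore`: nothing is required at `s`;
* `reject`: the requirement fails at `s`;
* `allOptimal`: all actions tie conditionally, so every action has to be optimal at `s`. -/
inductive NullFiberRule
  | ignore
  | reject
  | allOptimal

namespace StochasticDecisionProblem

variable (D : StochasticDecisionProblem)

abbrev Action : Type := Fin D.numActions

abbrev State : Type := (i : Fin D.n) → Fin (D.card i)

/-- The values of the coordinates in `I`. -/
abbrev Signal (I : Finset (Fin D.n)) : Type := (i : I) → Fin (D.card i)

/-- `Opt(s)`: the maximizers of `U(·, s)`. -/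
def Opt (s : D.State) : Set D.Action :=
  {a | ∀ b, D.U b s ≤ D.U a s}

/-- The fiber `{s : s_I = α}`. -/
def fiber (I : Finset (Fin D.n)) (α : D.Signal I) : Finset D.State :=
  Finset.univ.filter fun s => I.restrict s = α

/-- The probability of the event `S_I = α`. -/
def fiberProb (I : Finset (Fin D.n)) (α : D.Signal I) : ℚ :=
  ∑ s ∈ D.fiber I α, D.P s

/-- `α` lies in the support of `S_I`. -/
def Admissible (I : Finset (Fin D.n)) (α : D.Signal I) : Prop :=
  0 < D.fiberProb I α

/-- `E[U(a, S) | S_I = α]`; it is used only for admissible `α`. -/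
def condUtility (I : Finset (Fin D.n)) (α : D.Signal I) (a : D.Action) : ℚ :=
  (∑ s ∈ D.fiber I α, D.P s * D.U a s) / D.fiberProb I α

/-- The conditional optimizer: the maximizers of `E[U(·, S) | S_I = α]`, for admissible `α`. -/
def OptStoch (I : Finset (Fin D.n)) (α : D.Signal I) : Set D.Action :=
  {a | ∀ b, D.condUtility I α b ≤ D.condUtility I α a}

/-- What is required at a state whose fiber has probability zero. -/
def NullFiberCondition (s : D.State) : NullFiberRule → Prop
  | .ignore => True
  | .reject => False
  | .allOptimal => D.Opt s = Set.univ

/-- `I` is stochastically sufficient: at every state, the conditional optimizer given the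
coordinates in `I` is the optimizer given the full state. -/
def StochasticallySufficient (r : NullFiberRule) (I : Finset (Fin D.n)) : Prop :=
  ∀ s : D.State,
    (D.Admissible I (I.restrict s) → D.OptStoch I (I.restrict s) = D.Opt s) ∧
    (¬ D.Admissible I (I.restrict s) → D.NullFiberCondition s r)

end StochasticDecisionProblem

/-- An input of the decision problem: a stochastic decision problem and a coordinate set. -/
abbrev StochasticSufficiencyInput : Type :=
  (D : StochasticDecisionProblem) × Finset (Fin D.n)

/-! The explicit-state encoding, over the alphabet `blank, bit0, bit1, bra, ket, comma`. -/

namespace ExplicitState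

open Computability

/-- A string terminated by a comma. -/
def field (l : List Γ') : List Γ' := l ++ [Γ'.comma]

/-- A string in brackets. -/
def bracket (l : List Γ') : List Γ' := Γ'.bra :: l ++ [Γ'.ket]

/-- A natural number in binary. -/
def encNat (k : ℕ) : List Γ' := (encodeNat k).map Γ'.bit

/-- A rational number: a sign bit (set for negative numbers), the absolute value of the numerator
in binary, a blank, and the denominator in binary, in lowest terms. -/
def encRat (q : ℚ) : List Γ' :=
  Γ'.bit (decide (q < 0)) :: encNat q.num.natAbs ++ Γ'.blank :: encNat q.den

/-- The list of all states, in mixed-radix order. -/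
def states (D : StochasticDecisionProblem) : List D.State :=
  (List.finRange (∏ i, D.card i)).map fun k => finPiFinEquiv.symm k

/-- The table row of a state: its coordinates, its probability, and the utility of every action. -/
def encRow (D : StochasticDecisionProblem) (s : D.State) : List Γ' :=
  bracket (
    bracket ((List.finRange D.n).flatMap fun i => field (encNat (s i))) ++
    field (encRat (D.P s)) ++
    bracket ((List.finRange D.numActions).flatMap fun a => field (encRat (D.U a s))))

/-- The number of actions, the sizes of the coordinate spaces, the indicator vector of the
coordinate set, and the full table with one row for every state. -/
def encode (x : StochasticSufficiencyInput) : List Γ' :=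
  field (encNat x.1.numActions) ++
  bracket ((List.finRange x.1.n).flatMap fun i => field (encNat (x.1.card i))) ++
  bracket ((List.finRange x.1.n).map fun i => Γ'.bit (decide (i ∈ x.2))) ++
  (states x.1).flatMap (encRow x.1)

end ExplicitState

/-- A predicate on a type of instances, presented by an encoding as strings, is decidable in
polynomial time: a Turing machine outputs its truth value on the encoding of each instance, in a
number of steps bounded by a polynomial in the length of that encoding. -/
def PolyTimeDecidable {α Γ : Type} (enc : α → List Γ) (p : α → Prop) : Prop :=
  ∃ f : α → Bool, (∀ x, f x = true ↔ p x) ∧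
    Nonempty (Turing.TM2ComputableInPolyTime enc Computability.encodeBool f)

/-! Since the whole table is part of the input, sufficiency can be tested directly. For each row,
collect the rows that agree with it on the coordinates in `I`, and add up the products of
probability and utility, action by action. Dividing by the positive probability of the fiber does
not change the maximizers, so the unnormalized sums are compared. Probabilities are nonnegative, so
a fiber is null exactly when no row in it has positive probability. This takes polynomially many
arithmetic operations, all of them exact.

The numbers must also stay short. Fractions are never reduced, but adding one to an accumulator
lengthens the accumulator by an amount that depends on the new summand alone (`Frac.length_add_le`,
`vecLength_addVec_le`). A fold over the table therefore keeps all numbers polynomially long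
(`PolyTime.foldl_of_measure`).

To turn this into a machine, data are represented by binary trees on a stack, and `PolyTime` is the
class of functions computed by program fragments with a polynomial bound on time and output size. It
is closed under composition, pairing, case distinction (`PolyTime.listCases`) and loops whose length
and states are polynomially bounded (`PolyTime.iterate`). Arithmetic, parsing and the test are built
from these. Correctness splits into `rows_parse_encode` for the parser and `check_map_stateRow` for
the test; `polyTimeDecidable_of_polyTime` adds reading the input and writing the answer. -/

namespace StackMachine

/-! ### Structured programs for a machine with six stacks -/

open Computability Turing

/-- The stacks of the machine: besides the input and the output stack, `main` holds the values
being computed with, `save` holds values set aside, `count` and `copy` are auxiliary. -/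
inductive Stack
  | input
  | output
  | main
  | save
  | count
  | copy
  deriving DecidableEq

instance : Fintype Stack :=
  ⟨{.input, .output, .main, .save, .count, .copy}, fun k => by cases k <;> decide⟩

/-- The alphabet of each stack. -/
abbrev Sym : Stack → Type
  | .output => Bool
  | _ => Γ'

/-- The internal state of the machine: the symbol read last. -/
abbrev Var : Type := Option Γ'

abbrev Stacks : Type := ∀ k, List (Sym k)

/-- A piece of code with one entry and one exit. `code L e x` is the code, placed into a machine
with labels `L` by `e`, with exit label `x`. -/
structure Fragment where
  Lab : Type
  fin : Fintype Lab
  entry : Lab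
  code : ∀ L : Type, (Lab → L) → L → Lab → TM2.Stmt Sym L Var

/-- `c'` is reached from `c` in `n` steps. -/
def ReachesIn {L : Type} (m : L → TM2.Stmt Sym L Var) (n : ℕ) (c c' : TM2.Cfg Sym L Var) : Prop :=
  (flip bind (TM2.step m))^[n] (some c) = some c'

theorem ReachesIn.trans {L : Type} {m : L → TM2.Stmt Sym L Var} {n n' : ℕ}
    {c c' c'' : TM2.Cfg Sym L Var} (h : ReachesIn m n c c') (h' : ReachesIn m n' c' c'') :
    ReachesIn m (n + n') c c'' := by
  unfold ReachesIn at *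
  rw [Nat.add_comm, Function.iterate_add_apply, h, h']

theorem ReachesIn.step {L : Type} {m : L → TM2.Stmt Sym L Var} {l : L} {v : Var} {S : Stacks}
    {c' : TM2.Cfg Sym L Var} (h : TM2.stepAux (m l) v S = c') :
    ReachesIn m 1 ⟨some l, v, S⟩ c' := by
  subst h
  rfl

/-- Started at its entry, the fragment arrives at its exit within `t` steps. -/
def Runs (p : Fragment) (v : Var) (S : Stacks) (v' : Var) (S' : Stacks) (t : ℕ) : Prop :=
  ∀ (L : Type) (e : p.Lab → L) (x : L) (m : L → TM2.Stmt Sym L Var),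
    (∀ l, m (e l) = p.code L e x l) →
      ∃ n ≤ t, ReachesIn m n ⟨some (e p.entry), v, S⟩ ⟨some x, v', S'⟩

theorem Runs.mono {p : Fragment} {v v' : Var} {S S' : Stacks} {t t' : ℕ}
    (h : Runs p v S v' S' t) (ht : t ≤ t') : Runs p v S v' S' t' := fun L e x m hm =>
  let ⟨n, hn, hr⟩ := h L e x m hm
  ⟨n, hn.trans ht, hr⟩

/-- A single straight-line statement. -/
def op (g : ∀ L : Type, TM2.Stmt Sym L Var → TM2.Stmt Sym L Var) : Fragment where
  Lab := Unit
  fin := inferInstance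
  entry := ()
  code L _ x _ := g L (.goto fun _ => x)

theorem Runs.op {g : ∀ L : Type, TM2.Stmt Sym L Var → TM2.Stmt Sym L Var} {v v' : Var}
    {S S' : Stacks} (h : ∀ (L : Type) (q : TM2.Stmt Sym L Var),
      TM2.stepAux (g L q) v S = TM2.stepAux q v' S') :
    Runs (op g) v S v' S' 1 := fun L e x m hm =>
  ⟨1, le_rfl, ReachesIn.step (by rw [hm]; exact h L _)⟩

/-- Sequential composition. -/
def Fragment.seq (p q : Fragment) : Fragment where
  Lab := p.Lab ⊕ q.Lab
  fin := letI := p.fin; letI := q.fin; inferInstance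
  entry := .inl p.entry
  code L e x
    | .inl l => p.code L (e ∘ .inl) (e (.inr q.entry)) l
    | .inr l => q.code L (e ∘ .inr) x l

/-- `Runs` speaks of every machine that contains the code, so `p` can be run inside the composite
with the entry of `q` as its exit. -/
theorem Runs.seq {p q : Fragment} {v v' v'' : Var} {S S' S'' : Stacks} {t t' : ℕ}
    (h : Runs p v S v' S' t) (h' : Runs q v' S' v'' S'' t') :
    Runs (p.seq q) v S v'' S'' (t + t') := fun L e x m hm => by
  obtain ⟨n, hn, hr⟩ := h L (e ∘ .inl) (e (.inr q.entry)) m fun l => hm (.inl l)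
  obtain ⟨n', hn', hr'⟩ := h' L (e ∘ .inr) x m fun l => hm (.inr l)
  exact ⟨n + n', by omega, hr.trans hr'⟩

/-- Conditional on the symbol read last. -/
def cond (c : Var → Bool) (p q : Fragment) : Fragment where
  Lab := Option (p.Lab ⊕ q.Lab)
  fin := letI := p.fin; letI := q.fin; inferInstance
  entry := none
  code L e x
    | none => .branch c (.goto fun _ => e (some (.inl p.entry)))
        (.goto fun _ => e (some (.inr q.entry)))
    | some (.inl l) => p.code L (e ∘ some ∘ .inl) x l
    | some (.inr l) => q.code L (e ∘ some ∘ .inr) x l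

theorem Runs.cond_true {c : Var → Bool} {p q : Fragment} {v v' : Var} {S S' : Stacks} {t : ℕ}
    (hc : c v = true) (h : Runs p v S v' S' t) :
    Runs (cond c p q) v S v' S' (t + 1) := fun L e x m hm => by
  obtain ⟨n, hn, hr⟩ := h L (e ∘ some ∘ .inl) x m fun l => hm (some (.inl l))
  refine ⟨1 + n, by omega, ReachesIn.trans (ReachesIn.step ?_) hr⟩
  change TM2.stepAux (m (e none)) v S = _
  rw [hm none]
  simp only [cond, TM2.stepAux, hc, Bool.cond_true]
  rfl

theorem Runs.cond_false {c : Var → Bool} {p q : Fragment} {v v' : Var} {S S' : Stacks} {t : ℕ}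
    (hc : c v = false) (h : Runs q v S v' S' t) :
    Runs (cond c p q) v S v' S' (t + 1) := fun L e x m hm => by
  obtain ⟨n, hn, hr⟩ := h L (e ∘ some ∘ .inr) x m fun l => hm (some (.inr l))
  refine ⟨1 + n, by omega, ReachesIn.trans (ReachesIn.step ?_) hr⟩
  change TM2.stepAux (m (e none)) v S = _
  rw [hm none]
  simp only [cond, TM2.stepAux, hc, Bool.cond_false]
  rfl

/-- Repeat `p` while the symbol read last satisfies `c`. -/
def loop (c : Var → Bool) (p : Fragment) : Fragment where
  Lab := Option p.Lab
  fin := letI := p.fin; inferInstance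
  entry := none
  code L e x
    | none => .branch c (.goto fun _ => e (some p.entry)) (.goto fun _ => x)
    | some l => p.code L (e ∘ some) (e none) l

theorem Runs.loop_false {c : Var → Bool} {p : Fragment} {v : Var} {S : Stacks}
    (hc : c v = false) : Runs (loop c p) v S v S 1 := fun L e x m hm => by
  refine ⟨1, le_rfl, ReachesIn.step ?_⟩
  change TM2.stepAux (m (e none)) v S = _
  rw [hm none]
  simp only [loop, TM2.stepAux, hc, Bool.cond_false]

theorem Runs.loop_true {c : Var → Bool} {p : Fragment} {v v' v'' : Var} {S S' S'' : Stacks}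
    {t t' : ℕ} (hc : c v = true) (h : Runs p v S v' S' t) (h' : Runs (loop c p) v' S' v'' S'' t') :
    Runs (loop c p) v S v'' S'' (t' + t + 1) := fun L e x m hm => by
  obtain ⟨n, hn, hr⟩ := h L (e ∘ some) (e none) m fun l => hm (some l)
  obtain ⟨n', hn', hr'⟩ := h' L e x m hm
  refine ⟨1 + n + n', by omega, ReachesIn.trans (ReachesIn.trans (ReachesIn.step ?_) hr) hr'⟩
  change TM2.stepAux (m (e none)) v S = _
  rw [hm none]
  simp only [loop, TM2.stepAux, hc, Bool.cond_true]
  rfl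

/-- The Turing machine that runs a fragment and halts. -/
def toFinTM2 (p : Fragment) : FinTM2 :=
  letI := p.fin
  { K := Stack
    k₀ := .input
    k₁ := .output
    Γ := Sym
    Λ := Option p.Lab
    main := some p.entry
    σ := Var
    initialState := none
    Γk₀Fin := inferInstanceAs (Fintype Γ')
    m := fun l => l.elim .halt (p.code _ some none) }

/-- The contents of all stacks. -/
def contents (i : List Γ') (o : List Bool) (a b c d : List Γ') : Stacks
  | .input => i
  | .output => o
  | .main => a
  | .save => b
  | .count => c
  | .copy => d

section

variable (i : List Γ') (o : List Bool) (a b c d l : List Γ')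

@[simp] theorem contents_input : contents i o a b c d .input = i := rfl
@[simp] theorem contents_output : contents i o a b c d .output = o := rfl
@[simp] theorem contents_main : contents i o a b c d .main = a := rfl
@[simp] theorem contents_save : contents i o a b c d .save = b := rfl
@[simp] theorem contents_count : contents i o a b c d .count = c := rfl
@[simp] theorem contents_copy : contents i o a b c d .copy = d := rfl

@[simp] theorem update_input :
    Function.update (contents i o a b c d) .input l = contents l o a b c d := by
  funext k; cases k <;> rfl

@[simp] theorem update_output (o' : List Bool) :
    Function.update (contents i o a b c d) .output o' = contents i o' a b c d := by
  funext k; cases k <;> rfl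

@[simp] theorem update_main :
    Function.update (contents i o a b c d) .main l = contents i o l b c d := by
  funext k; cases k <;> rfl

@[simp] theorem update_save :
    Function.update (contents i o a b c d) .save l = contents i o a l c d := by
  funext k; cases k <;> rfl

@[simp] theorem update_count :
    Function.update (contents i o a b c d) .count l = contents i o a b l d := by
  funext k; cases k <;> rfl

@[simp] theorem update_copy :
    Function.update (contents i o a b c d) .copy l = contents i o a b c l := by
  funext k; cases k <;> rfl

end

/-- The exit label is `none`, where the machine halts; this accounts for the additional step. -/
theorem outputs_of_runs {p : Fragment} {l : List Γ'} {o : List Bool} {t : ℕ}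
    (h : Runs p none (contents l [] [] [] [] []) none (contents [] o [] [] [] []) t) :
    Nonempty (TM2OutputsInTime (toFinTM2 p) l (some o) (t + 1)) := by
  obtain ⟨n, hn, hr⟩ := h (Option p.Lab) some none (fun l => l.elim .halt (p.code _ some none))
    fun l => rfl
  have hi : initList (toFinTM2 p) l = ⟨some (some p.entry), none, contents l [] [] [] [] []⟩ := by
    unfold initList
    congr 1
    funext k
    cases k <;> rfl
  have ho : haltList (toFinTM2 p) o = ⟨none, none, contents [] o [] [] [] []⟩ := by
    unfold haltList
    congr 1
    funext k
    cases k <;> rfl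
  refine ⟨⟨⟨n + 1, ?_⟩, Nat.succ_le_succ hn⟩⟩
  rw [hi]
  exact Eq.trans (hr.trans (ReachesIn.step rfl)) (congrArg some ho.symm)

/-! ### Binary trees on the contents -/

/-- Binary trees, the data type of the machine. -/
inductive Tree
  | nil
  | cons (a b : Tree)

/-- A tree in prefix notation. -/
def Tree.code : Tree → List Γ'
  | .nil => [.bit false]
  | .cons a b => .bit true :: (a.code ++ b.code)

def Tree.size (t : Tree) : ℕ := t.code.length

@[simp] theorem Tree.size_nil : Tree.nil.size = 1 := rfl

@[simp] theorem Tree.size_cons (a b : Tree) : (Tree.cons a b).size = a.size + b.size + 1 := by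
  simp [Tree.size, Tree.code]

/-- The contents of the contents between the execution of instructions. -/
abbrev values (a b : List Γ') : Stacks := contents [] [] a b [] []

def pushMain (s : Γ') : Fragment := op fun _ q => .push .main (fun _ => s) q

theorem runs_pushMain (s : Γ') (v : Var) (a b : List Γ') :
    Runs (pushMain s) v (values a b) v (values (s :: a) b) 1 :=
  Runs.op fun _ _ => by simp [TM2.stepAux]

def popMain : Fragment := op fun _ q => .pop .main (fun _ s => s) q

theorem runs_popMain (s : Γ') (v : Var) (a b : List Γ') :
    Runs popMain v (values (s :: a) b) (some s) (values a b) 1 :=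
  Runs.op fun _ _ => by simp [TM2.stepAux]

def mark : Fragment := op fun _ q => .push .save (fun _ => .comma) q

theorem runs_mark (v : Var) (a b : List Γ') :
    Runs mark v (values a b) v (values a (.comma :: b)) 1 :=
  Runs.op fun _ _ => by simp [TM2.stepAux]

/-- Move one symbol from `main` to the chosen ones of `save` and `copy`, keeping on `count` one mark for each tree
that is still to be read. -/
def moveSymbol (toSave toCopy : Bool) : Fragment := op fun _ q =>
  .pop .main (fun _ s => s) <|
  (if toSave then .push .save (fun v => v.getD .blank) else id) <|
  (if toCopy then .push .copy (fun v => v.getD .blank) else id) <|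
  .branch (fun v => v = some (.bit true))
    (.push .count (fun _ => .blank) <| .peek .count (fun _ s => s) q)
    (.pop .count (fun v _ => v) <| .peek .count (fun _ s => s) q)

/-- Remove a tree from `main` and append its reverse to the chosen stacks. -/
def moveTree (toSave toCopy : Bool) : Fragment :=
  (op fun _ q => .push .count (fun _ => .blank) <| .peek .count (fun _ s => s) q).seq <|
  loop Option.isSome (moveSymbol toSave toCopy)

theorem runs_moveSymbol_true (ts tc : Bool) (v : Var) (a b c d : List Γ') :
    Runs (moveSymbol ts tc) v (contents [] [] (.bit true :: a) b c d) (some .blank)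
      (contents [] [] a (if ts then .bit true :: b else b) (.blank :: c)
        (if tc then .bit true :: d else d)) 1 :=
  Runs.op fun _ _ => by cases ts <;> cases tc <;> simp [TM2.stepAux]

theorem runs_moveSymbol_false (ts tc : Bool) (v : Var) (s : Γ') (a b c d : List Γ') :
    Runs (moveSymbol ts tc) v (contents [] [] (.bit false :: a) b (s :: c) d) c.head?
      (contents [] [] a (if ts then .bit false :: b else b) c
        (if tc then .bit false :: d else d)) 1 :=
  Runs.op fun _ _ => by cases ts <;> cases tc <;> simp [TM2.stepAux]

/-- In prefix notation a node replaces one pending tree by two and a leaf completes one, so the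
marks on `count` tell where the tree ends. The rest of the run is a hypothesis, so that the
induction can pass from the left subtree to the right one within the same loop. Each symbol costs a
branch and a move. -/
theorem runs_loop_moveSymbol (ts tc : Bool) (t : Tree) {v v' : Var} {a b c d : List Γ'}
    {S : Stacks} {n : ℕ} (hv : v.isSome)
    (h : Runs (loop Option.isSome (moveSymbol ts tc)) c.head?
      (contents [] [] a (if ts then t.code.reverse ++ b else b) c
        (if tc then t.code.reverse ++ d else d)) v' S n) :
    Runs (loop Option.isSome (moveSymbol ts tc)) v
      (contents [] [] (t.code ++ a) b (.blank :: c) d) v' S (n + 2 * t.size) := by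
  induction t generalizing v a b c d n with
  | nil =>
    exact Runs.loop_true hv (runs_moveSymbol_false ts tc v _ a b c d) h
  | cons x y hx hy =>
    have hc : (x.cons y).code ++ a = .bit true :: (x.code ++ (y.code ++ a)) := by
      simp [Tree.code]
    rw [hc]
    refine (Runs.loop_true hv (runs_moveSymbol_true ts tc v _ b _ d)
      (hx (v := some .blank) (c := .blank :: c) rfl (hy rfl (n := n) ?_))).mono ?_
    · convert h using 2 <;> split_ifs <;> simp [Tree.code]
    · simp; omega

theorem runs_moveTree (ts tc : Bool) (t : Tree) (v : Var) (a b : List Γ') :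
    Runs (moveTree ts tc) v (values (t.code ++ a) b) none
      (contents [] [] a (if ts then t.code.reverse ++ b else b) []
        (if tc then t.code.reverse else [])) (2 * t.size + 2) := by
  refine (Runs.seq (v' := some .blank) (S' := contents [] [] (t.code ++ a) b [.blank] [])
    (Runs.op fun _ _ => ?_)
    (runs_loop_moveSymbol ts tc t rfl (n := 1) ?_)).mono (by omega)
  · simp [TM2.stepAux]
  · simpa using Runs.loop_false rfl

/-- Return the symbols above the uppermost mark on `save` to `main`, and remove the mark. -/
def unsave : Fragment :=
  (op fun _ q => .pop .save (fun _ s => s) q).seq <|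
  loop (fun v => v ≠ some .comma)
    (op fun _ q => .push .main (fun v => v.getD .blank) <| .pop .save (fun _ s => s) q)

theorem runs_unsave {l : List Γ'} (hl : Γ'.comma ∉ l) (v : Var) (a b d : List Γ') :
    Runs unsave v (contents [] [] a (l ++ .comma :: b) [] d) (some .comma)
      (contents [] [] (l.reverse ++ a) b [] d) (2 * l.length + 2) := by
  -- The loop is entered with one symbol already popped, hence the head and the tail.
  have key : ∀ (l : List Γ') (_ : Γ'.comma ∉ l) (a : List Γ'),
      Runs (loop (fun v => v ≠ some .comma)
        (op fun _ q => .push .main (fun v => v.getD .blank) <| .pop .save (fun _ s => s) q))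
        (l ++ .comma :: b).head? (contents [] [] a (l ++ .comma :: b).tail [] d) (some .comma)
        (contents [] [] (l.reverse ++ a) b [] d) (2 * l.length + 1) := by
    intro l
    induction l with
    | nil => exact fun _ a => Runs.loop_false (by simp)
    | cons s l ih =>
      intro hl a
      simp only [List.mem_cons, not_or] at hl
      refine (Runs.loop_true (by simpa using Ne.symm hl.1) (Runs.op fun _ _ => ?_)
        (by simpa using ih hl.2 (s :: a))).mono (by simp; omega)
      simp [TM2.stepAux]
  refine (Runs.seq (Runs.op fun _ _ => ?_) (key l hl a)).mono (by omega)
  simp [TM2.stepAux]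

/-- Return the symbols on `copy` to `main`. -/
def uncopy : Fragment :=
  (op fun _ q => .pop .copy (fun _ s => s) q).seq <|
  loop Option.isSome
    (op fun _ q => .push .main (fun v => v.getD .blank) <| .pop .copy (fun _ s => s) q)

theorem runs_uncopy (l : List Γ') (v : Var) (a b : List Γ') :
    Runs uncopy v (contents [] [] a b [] l) none
      (values (l.reverse ++ a) b) (2 * l.length + 2) := by
  have key : ∀ (l a : List Γ'),
      Runs (loop Option.isSome
        (op fun _ q => .push .main (fun v => v.getD .blank) <| .pop .copy (fun _ s => s) q))
        l.head? (contents [] [] a b [] l.tail) none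
        (values (l.reverse ++ a) b) (2 * l.length + 1) := by
    intro l
    induction l with
    | nil => exact fun a => Runs.loop_false rfl
    | cons s l ih =>
      intro a
      refine (Runs.loop_true rfl (Runs.op fun _ _ => ?_)
        (by simpa using ih (s :: a))).mono (by simp; omega)
      simp [TM2.stepAux]
  refine (Runs.seq (Runs.op fun _ _ => ?_) (key l a)).mono (by omega)
  simp [TM2.stepAux]

/-- Codes consist of bits only, so a comma on `save` reliably delimits a saved tree. -/
theorem Tree.comma_notMem_code (t : Tree) : Γ'.comma ∉ t.code := by
  induction t <;> simp_all [Tree.code]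

theorem Tree.comma_notMem_reverse_code (t : Tree) : Γ'.comma ∉ t.code.reverse := by
  simpa using t.comma_notMem_code

theorem Tree.length_code (t : Tree) : t.code.length = t.size := rfl

def drop : Fragment := moveTree false false

theorem runs_drop (t : Tree) (v : Var) (a b : List Γ') :
    Runs drop v (values (t.code ++ a) b) none (values a b) (2 * t.size + 2) :=
  runs_moveTree false false t v a b

def save : Fragment := mark.seq (moveTree true false)

theorem runs_save (t : Tree) (v : Var) (a b : List Γ') :
    Runs save v (values (t.code ++ a) b) none (values a (t.code.reverse ++ .comma :: b))
      (2 * t.size + 3) :=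
  (Runs.seq (runs_mark _ _ _) (runs_moveTree true false t v a _)).mono (by omega)

theorem runs_unsave_code (t : Tree) (v : Var) (a b : List Γ') :
    Runs unsave v (values a (t.code.reverse ++ .comma :: b)) (some .comma)
      (values (t.code ++ a) b) (2 * t.size + 2) := by
  simpa [Tree.length_code] using runs_unsave t.comma_notMem_reverse_code v a b []

def dup : Fragment := mark.seq <| (moveTree true true).seq <| unsave.seq uncopy

theorem runs_dup (t : Tree) (v : Var) (a b : List Γ') :
    Runs dup v (values (t.code ++ a) b) none (values (t.code ++ (t.code ++ a)) b)
      (6 * t.size + 7) := by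
  have h : Runs uncopy (some .comma) (contents [] [] (t.code ++ a) b [] t.code.reverse) none
      (values (t.code ++ (t.code ++ a)) b) (2 * t.size + 2) := by
    simpa [Tree.length_code] using runs_uncopy t.code.reverse (some .comma) (t.code ++ a) b
  refine (Runs.seq (runs_mark _ _ _) <| Runs.seq (runs_moveTree true true t v a _) <|
    Runs.seq (runs_unsave t.comma_notMem_reverse_code _ a b _) (by simpa using h)).mono ?_
  simp [Tree.length_code]
  omega

/-- The upper tree waits on `save` and the lower one on `copy`; restoring `save` first puts the
formerly upper tree below. -/
def swap : Fragment := save.seq <| (moveTree false true).seq <| unsave.seq uncopy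

theorem runs_swap (t u : Tree) (v : Var) (a b : List Γ') :
    Runs swap v (values (t.code ++ (u.code ++ a)) b) none (values (u.code ++ (t.code ++ a)) b)
      (4 * t.size + 4 * u.size + 9) := by
  have h : Runs uncopy (some .comma) (contents [] [] (t.code ++ a) b [] u.code.reverse) none
      (values (u.code ++ (t.code ++ a)) b) (2 * u.size + 2) := by
    simpa [Tree.length_code] using runs_uncopy u.code.reverse (some .comma) (t.code ++ a) b
  refine (Runs.seq (runs_save t _ _ _) <| Runs.seq (runs_moveTree false true u _ a _) <|
    Runs.seq (runs_unsave t.comma_notMem_reverse_code _ a b _) (by simpa using h)).mono ?_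
  simp [Tree.length_code]
  omega

/-! ### Tree encodings and functions computable in polynomial time -/

theorem eval_mono (P : Polynomial ℕ) {m n : ℕ} (h : m ≤ n) : P.eval m ≤ P.eval n := by
  simp only [Polynomial.eval_eq_sum, Polynomial.sum]
  gcongr

/-- A representation of the elements of a type by trees. -/
class Enc (α : Type) where
  toTree : α → Tree

section

variable {α β γ δ σ : Type} [Enc α] [Enc β] [Enc γ] [Enc δ] [Enc σ]

def code (x : α) : List Γ' := (Enc.toTree x).code

def size (x : α) : ℕ := (Enc.toTree x).size

/-- For truth values as for lists, the first symbol of the code separates the two cases, so a test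
only peeks at one symbol. -/
instance : Enc Bool := ⟨fun b => bif b then .cons .nil .nil else .nil⟩

instance : Enc (α × β) := ⟨fun x => .cons (Enc.toTree x.1) (Enc.toTree x.2)⟩

instance : Enc (List α) := ⟨List.foldr (fun x t => .cons (Enc.toTree x) t) .nil⟩

@[simp] theorem size_true : size true = 3 := rfl

@[simp] theorem size_false : size false = 1 := rfl

theorem size_bool_le (b : Bool) : size b ≤ 3 := by cases b <;> simp

@[simp] theorem size_pair (x : α) (y : β) : size (x, y) = size x + size y + 1 :=
  Tree.size_cons _ _

@[simp] theorem size_nil : size ([] : List α) = 1 := rfl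

@[simp] theorem size_cons (x : α) (l : List α) : size (x :: l) = size x + size l + 1 :=
  Tree.size_cons _ _

theorem size_pos (x : α) : 0 < size x := by
  unfold size
  cases Enc.toTree x <;> simp

theorem code_pair (x : α) (y : β) : code (x, y) = .bit true :: (code x ++ code y) := rfl

theorem code_cons (x : α) (l : List α) : code (x :: l) = .bit true :: (code x ++ code l) := rfl

theorem length_le_size (l : List α) : l.length ≤ size l := by
  induction l with
  | nil => simp
  | cons x l ih => simp; omega

theorem size_append (l l' : List α) : size (l ++ l') + 1 = size l + size l' := by
  induction l with
  | nil => simp +arith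
  | cons x l ih => simp at *; omega

theorem size_reverse (l : List α) : size l.reverse = size l := by
  induction l with
  | nil => rfl
  | cons x l ih =>
    have := size_append l.reverse [x]
    simp at *
    omega

theorem size_le_of_mem {l : List α} {x : α} (h : x ∈ l) : size x < size l := by
  induction l with
  | nil => simp at h
  | cons y l ih =>
    rcases List.mem_cons.1 h with rfl | h
    · simp +arith
    · have := ih h
      simp; omega

theorem size_drop_le (l : List α) (i : ℕ) : size (l.drop i) ≤ size l := by
  have h := size_append (l.take i) (l.drop i)
  have := size_pos (l.take i)
  rw [List.take_append_drop] at h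
  omega

/-- `f` is computed by a fragment in polynomial time. The fragment replaces the argument on top of
`main` by the value of `f`. -/
@[fun_prop]
def PolyTime (f : α → β) : Prop :=
  -- The bound on the output size is what makes compositions polynomial. The contents `a` and `b`
  -- are arbitrary, so that other values can be parked below and on `save`.
  ∃ (p : Fragment) (P : Polynomial ℕ), ∀ x, size (f x) ≤ P.eval (size x) ∧
    ∀ v a b, ∃ v', Runs p v (values (code x ++ a) b) v' (values (code (f x) ++ a) b)
      (P.eval (size x))

namespace PolyTime

theorem size_le {f : α → β} (h : PolyTime f) :
    ∃ P : Polynomial ℕ, ∀ x, size (f x) ≤ P.eval (size x) :=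
  let ⟨_, P, h⟩ := h
  ⟨P, fun x => (h x).1⟩

theorem of_toTree_eq {f : α → β} (h : ∀ x, Enc.toTree (f x) = Enc.toTree x) : PolyTime f := by
  refine ⟨op fun _ q => q, .X + 1, fun x => ⟨?_, fun v a b => ⟨v, ?_⟩⟩⟩
  · simp [size, h]
  · simp only [code, h]
    exact (Runs.op fun _ _ => rfl).mono (by simp)

@[fun_prop]
protected theorem id : PolyTime (fun x : α => x) := of_toTree_eq fun _ => rfl

@[fun_prop]
theorem comp {g : β → γ} {f : α → β} (hg : PolyTime g) (hf : PolyTime f) :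
    PolyTime fun x => g (f x) := by
  obtain ⟨p, P, hf⟩ := hf
  obtain ⟨q, Q, hg⟩ := hg
  refine ⟨p.seq q, P + Q.comp P, fun x => ?_⟩
  have h := eval_mono Q (hf x).1
  simp only [Polynomial.eval_add, Polynomial.eval_comp]
  refine ⟨(hg (f x)).1.trans (by omega), fun v a b => ?_⟩
  obtain ⟨v', hv'⟩ := (hf x).2 v a b
  obtain ⟨v'', hv''⟩ := (hg (f x)).2 v' a b
  exact ⟨v'', (hv'.seq hv'').mono (by omega)⟩

@[fun_prop]
-- The argument is duplicated, and the value of `f` waits on `save` while `g` is evaluated on the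
-- second copy.
theorem pair {f : α → β} {g : α → γ} (hf : PolyTime f) (hg : PolyTime g) :
    PolyTime fun x => (f x, g x) := by
  obtain ⟨p, P, hf⟩ := hf
  obtain ⟨q, Q, hg⟩ := hg
  refine ⟨dup.seq <| p.seq <| save.seq <| q.seq <| unsave.seq <| pushMain (.bit true),
    6 * .X + 5 * P + Q + 13, fun x => ?_⟩
  have h₁ := (hf x).1
  have h₂ := (hg x).1
  simp only [Polynomial.eval_add, Polynomial.eval_mul, Polynomial.eval_ofNat, Polynomial.eval_X,
    size_pair]
  refine ⟨by omega, fun v a b => ?_⟩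
  obtain ⟨v', hv'⟩ := (hf x).2 none (code x ++ a) b
  obtain ⟨v'', hv''⟩ := (hg x).2 none a ((code (f x)).reverse ++ .comma :: b)
  have hc : code (f x, g x) ++ a = .bit true :: (code (f x) ++ (code (g x) ++ a)) := by
    simp [code_pair]
  rw [hc]
  refine ⟨some .comma, ((runs_dup (Enc.toTree x) v a b).seq <| hv'.seq <|
    (runs_save (Enc.toTree (f x)) _ _ b).seq <| hv''.seq <|
    (runs_unsave_code (Enc.toTree (f x)) _ _ b).seq <| runs_pushMain _ _ _ _).mono ?_⟩
  simp only [size] at *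
  omega

theorem fst_prod : PolyTime (fun x : α × β => x.1) := by
  refine ⟨popMain.seq <| swap.seq drop, 6 * .X + 12, fun x => ?_⟩
  obtain ⟨x, y⟩ := x
  simp only [Polynomial.eval_add, Polynomial.eval_mul, Polynomial.eval_ofNat, Polynomial.eval_X,
    size_pair]
  refine ⟨by omega, fun v a b => ⟨none, ?_⟩⟩
  rw [code_pair, List.cons_append, List.append_assoc]
  refine (Runs.seq (runs_popMain _ _ _ _) <| Runs.seq
    (runs_swap (Enc.toTree x) (Enc.toTree y) _ a b) <| runs_drop _ _ _ _).mono ?_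
  simp only [size]
  omega

theorem snd_prod : PolyTime (fun x : α × β => x.2) := by
  refine ⟨popMain.seq drop, 2 * .X + 3, fun x => ?_⟩
  obtain ⟨x, y⟩ := x
  simp only [Polynomial.eval_add, Polynomial.eval_mul, Polynomial.eval_ofNat, Polynomial.eval_X,
    size_pair]
  refine ⟨by omega, fun v a b => ⟨none, ?_⟩⟩
  rw [code_pair, List.cons_append, List.append_assoc]
  refine (Runs.seq (runs_popMain _ _ _ _) <| runs_drop (Enc.toTree x) _ _ _).mono ?_
  simp only [size]
  omega

@[fun_prop]
theorem fst {f : α → β × γ} (hf : PolyTime f) : PolyTime fun x => (f x).1 := fst_prod.comp hf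

@[fun_prop]
theorem snd {f : α → β × γ} (hf : PolyTime f) : PolyTime fun x => (f x).2 := snd_prod.comp hf

end PolyTime

/-- Push a word on `main`. -/
def pushWord (L : Type) (q : TM2.Stmt Sym L Var) (l : List Γ') : TM2.Stmt Sym L Var :=
  l.foldl (fun q s => .push .main (fun _ => s) q) q

/-- The fold makes the push of the last symbol outermost, so it is executed first and the word lies
on the stack in reading order. -/
theorem stepAux_pushWord {L : Type} (q : TM2.Stmt Sym L Var) (l : List Γ') (v : Var)
    (i : List Γ') (o : List Bool) (a b c d : List Γ') :
    TM2.stepAux (pushWord L q l) v (contents i o a b c d) =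
      TM2.stepAux q v (contents i o (l ++ a) b c d) := by
  induction l generalizing q with
  | nil => rfl
  | cons s l ih =>
    rw [pushWord, List.foldl_cons, ← pushWord, ih]
    simp [TM2.stepAux]

def peekMain : Fragment := op fun _ q => .peek .main (fun _ s => s) q

theorem runs_peekMain (s : Γ') (v : Var) (a b : List Γ') :
    Runs peekMain v (values (s :: a) b) (some s) (values (s :: a) b) 1 :=
  Runs.op fun _ _ => by simp [TM2.stepAux]

theorem runs_peekMain_bool (c : Bool) (v : Var) (a b : List Γ') :
    Runs peekMain v (values (code c ++ a) b) (some (.bit c)) (values (code c ++ a) b) 1 := by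
  cases c <;> exact runs_peekMain _ _ _ _

theorem runs_drop_code (x : α) (v : Var) (a b : List Γ') :
    Runs drop v (values (code x ++ a) b) none (values a b) (2 * size x + 2) :=
  runs_drop _ v a b

theorem runs_dup_code (x : α) (v : Var) (a b : List Γ') :
    Runs dup v (values (code x ++ a) b) none (values (code x ++ (code x ++ a)) b)
      (6 * size x + 7) :=
  runs_dup _ v a b

theorem runs_drop_bool (c : Bool) (v : Var) (a b : List Γ') :
    Runs drop v (values (code c ++ a) b) none (values a b) 8 :=
  (runs_drop_code c v a b).mono (by have := size_bool_le c; omega)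

/-- The symbol read last is the first symbol of a tree that is not `nil`. -/
def isTrue (v : Var) : Bool := v = some (.bit true)

@[simp] theorem isTrue_some_bit (c : Bool) : isTrue (some (.bit c)) = c := by
  cases c <;> rfl

namespace PolyTime

@[fun_prop]
theorem const (y : β) : PolyTime (fun _ : α => y) := by
  refine ⟨drop.seq <| op fun L q => pushWord L q (code y), 2 * .X + 3 + .C (size y), fun x => ?_⟩
  simp only [Polynomial.eval_add, Polynomial.eval_mul, Polynomial.eval_ofNat, Polynomial.eval_X,
    Polynomial.eval_C]
  refine ⟨by omega, fun v a b => ⟨none, ?_⟩⟩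
  exact (Runs.seq (runs_drop_code x v a b) <|
    Runs.op fun _ _ => stepAux_pushWord ..).mono (by omega)

@[fun_prop]
protected theorem ite {c : α → Bool} {f g : α → β} (hc : PolyTime c) (hf : PolyTime f)
    (hg : PolyTime g) : PolyTime fun x => if c x = true then f x else g x := by
  obtain ⟨r, R, hc⟩ := hc
  obtain ⟨p, P, hf⟩ := hf
  obtain ⟨q, Q, hg⟩ := hg
  refine ⟨dup.seq <| r.seq <| peekMain.seq <| cond isTrue (drop.seq p) (drop.seq q),
    6 * .X + 17 + R + P + Q, fun x => ?_⟩
  have h₁ := (hf x).1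
  have h₂ := (hg x).1
  simp only [Polynomial.eval_add, Polynomial.eval_mul, Polynomial.eval_ofNat, Polynomial.eval_X]
  refine ⟨by split <;> omega, fun v a b => ?_⟩
  obtain ⟨v', hv'⟩ := (hc x).2 none (code x ++ a) b
  cases h : c x
  · obtain ⟨v'', hv''⟩ := (hg x).2 none a b
    rw [h] at hv'
    refine ⟨v'', ((runs_dup_code x v a b).seq <| hv'.seq <| (runs_peekMain_bool _ _ _ _).seq <|
      Runs.cond_false (isTrue_some_bit _) <| (runs_drop_bool _ _ _ _).seq hv'').mono ?_⟩
    omega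
  · obtain ⟨v'', hv''⟩ := (hf x).2 none a b
    rw [h] at hv'
    refine ⟨v'', ((runs_dup_code x v a b).seq <| hv'.seq <| (runs_peekMain_bool _ _ _ _).seq <|
      Runs.cond_true (isTrue_some_bit _) <| (runs_drop_bool _ _ _ _).seq hv'').mono ?_⟩
    omega

@[fun_prop]
theorem cons {f : α → β} {g : α → List β} (hf : PolyTime f) (hg : PolyTime g) :
    PolyTime fun x => f x :: g x :=
  (of_toTree_eq fun _ => rfl : PolyTime fun x : β × List β => x.1 :: x.2).comp (hf.pair hg)

/-- A nonempty list has the same tree as the pair of its head and tail. After a swap with the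
argument, one pushed symbol thus forms the triple `(x, y, l')`. -/
theorem listCases {l : α → List β} {f : α → γ} {g : α → β → List β → γ} (hl : PolyTime l)
    (hf : PolyTime f) (hg : PolyTime fun x : α × β × List β => g x.1 x.2.1 x.2.2) :
    PolyTime fun x => match l x with
      | [] => f x
      | y :: l' => g x y l' := by
  obtain ⟨r, R, hl⟩ := hl
  obtain ⟨p, P, hf⟩ := hf
  obtain ⟨q, Q, hg⟩ := hg
  refine ⟨dup.seq <| r.seq <| peekMain.seq <| cond isTrue
    (swap.seq <| (pushMain (.bit true)).seq q) (drop.seq p),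
    10 * .X + 30 + 5 * R + P + Q.comp (.X + R + 1), fun x => ?_⟩
  have h₁ := (hf x).1
  have h₂ := (hl x).1
  simp only [Polynomial.eval_add, Polynomial.eval_mul, Polynomial.eval_ofNat, Polynomial.eval_X,
    Polynomial.eval_comp, Polynomial.eval_one]
  cases h : l x with
  | nil =>
    refine ⟨by dsimp only; omega, fun v a b => ?_⟩
    obtain ⟨v', hv'⟩ := (hl x).2 none (code x ++ a) b
    obtain ⟨v'', hv''⟩ := (hf x).2 none a b
    rw [h] at hv'
    refine ⟨v'', ((runs_dup_code x v a b).seq <| hv'.seq <| (runs_peekMain (.bit false) _ _ _).seq <|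
      Runs.cond_false (isTrue_some_bit _) <| (runs_drop_bool false _ _ _).seq hv'').mono ?_⟩
    omega
  | cons y l' =>
    have h₃ := (hg (x, y, l')).1
    rw [h] at h₂
    have h₄ : size (x, y, l') ≤ size x + R.eval (size x) + 1 := by
      simp only [size_pair, size_cons] at *
      omega
    have h₅ := eval_mono Q h₄
    refine ⟨by dsimp only at *; omega, fun v a b => ?_⟩
    obtain ⟨v', hv'⟩ := (hl x).2 none (code x ++ a) b
    obtain ⟨v'', hv''⟩ := (hg (x, y, l')).2 none a b
    rw [h] at hv'
    have hc : code (x, y, l') ++ a = .bit true :: (code x ++ (code (y :: l') ++ a)) := by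
      simp [code_pair, code_cons]
    rw [hc] at hv''
    refine ⟨v'', ((runs_dup_code x v a b).seq <| hv'.seq <| (runs_peekMain (.bit true) _ _ _).seq <|
      Runs.cond_true (isTrue_some_bit _) <|
        (runs_swap (Enc.toTree (y :: l')) (Enc.toTree x) _ _ _).seq <|
        (runs_pushMain _ _ _ _).seq hv'').mono ?_⟩
    simp only [size] at *
    omega

/-- Iteration while a condition holds. -/
theorem iterate {h : α → σ} {c : σ → Bool} {f : σ → σ} {g : α → σ} (hh : PolyTime h)
    (hc : PolyTime c) (hf : PolyTime f) (N P : Polynomial ℕ)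
    (H : ∀ x, ∃ n ≤ N.eval (size x), (∀ i < n, c (f^[i] (h x)) = true) ∧
      c (f^[n] (h x)) = false ∧ g x = f^[n] (h x) ∧
      ∀ i ≤ n, size (f^[i] (h x)) ≤ P.eval (size x)) : PolyTime g := by
  suffices hg : ∃ (p : Fragment) (Q : Polynomial ℕ), ∀ x, size (g x) ≤ Q.eval (size x) ∧
      ∀ v a b, ∃ v', Runs p v (values (code (h x) ++ a) b) v' (values (code (g x) ++ a) b)
        (Q.eval (size x)) by
    obtain ⟨r, R, hh⟩ := hh
    obtain ⟨p, Q, hg⟩ := hg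
    refine ⟨r.seq p, R + Q, fun x => ?_⟩
    rw [Polynomial.eval_add]
    refine ⟨(hg x).1.trans (by omega), fun v a b => ?_⟩
    obtain ⟨v', hv'⟩ := (hh x).2 v a b
    obtain ⟨v'', hv''⟩ := (hg x).2 v' a b
    exact ⟨v'', hv'.seq hv''⟩
  obtain ⟨q, Q, hc⟩ := hc
  obtain ⟨p, R, hf⟩ := hf
  let test : Fragment := dup.seq <| q.seq peekMain
  have htest : ∀ y v a b, Runs test v (values (code y ++ a) b) (some (.bit (c y)))
      (values (code (c y) ++ (code y ++ a)) b) (6 * size y + 8 + Q.eval (size y)) := by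
    intro y v a b
    obtain ⟨v', hv'⟩ := (hc y).2 none (code y ++ a) b
    exact ((runs_dup_code y v a b).seq <| hv'.seq <| runs_peekMain_bool _ _ _ _).mono (by omega)
  -- `B` bounds all iterates. The constant 17 per round is 8 for dropping the old test result, 8 for
  -- `test` and 1 for the branch.
  have key : ∀ (B n : ℕ) (y : σ), (∀ i < n, c (f^[i] y) = true) → c (f^[n] y) = false →
      (∀ i ≤ n, size (f^[i] y) ≤ B) → ∀ a b,
      Runs (loop isTrue (drop.seq <| p.seq test)) (some (.bit (c y)))
        (values (code (c y) ++ (code y ++ a)) b) (some (.bit false))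
        (values (code false ++ (code (f^[n] y) ++ a)) b)
        (n * (6 * B + Q.eval B + R.eval B + 17) + 1) := by
    intro B n
    induction n with
    | zero =>
      intro y _ hy _ a b
      simp only [Function.iterate_zero, id_eq] at hy
      rw [hy]
      exact (Runs.loop_false rfl).mono (by omega)
    | succ n ih =>
      intro y h₁ h₂ h₃ a b
      have hy := h₁ 0 (by omega)
      simp only [Function.iterate_zero, id_eq] at hy
      have h₀ := h₃ 0 (by omega)
      simp only [Function.iterate_zero, id_eq] at h₀
      have hfy : size (f y) ≤ B := by simpa using h₃ 1 (by omega)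
      have := ih (f y) (fun i hi => by simpa using h₁ (i + 1) (by omega)) (by simpa using h₂)
        (fun i hi => by simpa using h₃ (i + 1) (by omega)) a b
      obtain ⟨v', hv'⟩ := (hf y).2 none a b
      rw [hy]
      refine (Runs.loop_true (isTrue_some_bit _) ((runs_drop_bool _ _ _ _).seq <|
        hv'.seq (htest (f y) _ _ _)) (by simpa using this)).mono ?_
      have h₄ := eval_mono R h₀
      have h₅ := eval_mono Q hfy
      have h₆ := Nat.add_one_mul n (6 * B + Q.eval B + R.eval B + 17)
      omega
  -- The initial test is charged as one more round; 9 covers leaving the loop and dropping the last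
  -- test result.
  refine ⟨test.seq <| (loop isTrue (drop.seq <| p.seq test)).seq drop,
    (N + 1) * (6 * P + Q.comp P + R.comp P + 17) + 9, fun x => ?_⟩
  obtain ⟨n, hn, h₁, h₂, h₃, h₄⟩ := H x
  have h₅ := h₄ 0 (by omega)
  have h₆ := eval_mono Q h₅
  simp only [Function.iterate_zero, id_eq] at h₅ h₆
  simp only [Polynomial.eval_add, Polynomial.eval_mul, Polynomial.eval_ofNat,
    Polynomial.eval_comp, Polynomial.eval_one, h₃]
  set B := P.eval (size x)
  have h₇ : n * (6 * B + Q.eval B + R.eval B + 17) ≤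
      N.eval (size x) * (6 * B + Q.eval B + R.eval B + 17) := Nat.mul_le_mul_right _ hn
  rw [Nat.add_one_mul (N.eval _)]
  refine ⟨(h₄ n le_rfl).trans (by omega), fun v a b => ⟨none, ?_⟩⟩
  exact ((htest (h x) v a b).seq <| (key B n (h x) h₁ h₂ h₄ a b).seq <|
    runs_drop_bool _ _ _ _).mono (by omega)

end PolyTime

end

/-! ### Folds with bounded accumulators, and list operations -/

section

variable {α β γ δ σ : Type} [Enc α] [Enc β] [Enc γ] [Enc δ] [Enc σ]

namespace PolyTime

/-- The loop state holds the argument, the remaining list and the accumulator. A polynomial-time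
step may still let the accumulator grow exponentially under iteration, so `H` bounds all partial
folds. -/
theorem foldl {l : α → List β} {s : α → σ} {f : α → σ → β → σ} (hl : PolyTime l)
    (hs : PolyTime s) (hf : PolyTime fun x : α × σ × β => f x.1 x.2.1 x.2.2) (P : Polynomial ℕ)
    (H : ∀ x i, size (((l x).take i).foldl (f x) (s x)) ≤ P.eval (size x)) :
    PolyTime fun x => (l x).foldl (f x) (s x) := by
  obtain ⟨R, hR⟩ := hl.size_le
  let step : α × List β × σ → α × List β × σ := fun x => match x.2.1 with
    | [] => x
    | b :: l => (x.1, l, f x.1 x.2.2 b)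
  have hstep : PolyTime step := listCases (l := fun x : α × List β × σ => x.2.1)
    (f := fun x => x) (g := fun x b l => (x.1, l, f x.1 x.2.2 b)) (by fun_prop) (by fun_prop) (by
      refine pair (by fun_prop) (pair (by fun_prop) ?_)
      exact hf.comp (f := fun x : (α × List β × σ) × β × List β => (x.1.1, x.1.2.2, x.2.1))
        (by fun_prop))
  have hc : PolyTime fun x : α × List β × σ => !x.2.1.isEmpty := by
    have := listCases (l := fun x : α × List β × σ => x.2.1) (f := fun _ => false)
      (g := fun _ _ _ => true) (by fun_prop) (by fun_prop) (by fun_prop)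
    convert this using 2 with x
    cases x.2.1 <;> rfl
  have hi : ∀ x i, step^[i] (x, l x, s x) =
      (x, (l x).drop i, ((l x).take i).foldl (f x) (s x)) := by
    intro x i
    generalize l x = l
    generalize s x = s
    induction i generalizing l s with
    | zero => simp
    | succ i ih => cases l with
      | nil => simpa [step] using ih [] s
      | cons b l => simpa [step] using ih l (f x s b)
  have := iterate (h := fun x => (x, l x, s x)) (f := step)
    (g := fun x => (x, [], (l x).foldl (f x) (s x))) (by fun_prop) hc hstep R (.X + R + P + 2)
    fun x => ⟨(l x).length, (length_le_size _).trans (hR x), ?_, ?_, ?_, ?_⟩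
  · exact this.snd.snd
  · intro i hi'
    rw [hi]
    simpa using hi'
  · rw [hi]
    simp
  · rw [hi]
    simp
  · intro i _
    rw [hi]
    have h₁ := H x i
    have h₂ := (size_drop_le (l x) i).trans (hR x)
    simp only [size_pair, Polynomial.eval_add, Polynomial.eval_X, Polynomial.eval_ofNat]
    omega

/-- The increment of `μ` does not depend on the accumulator, so `μ` grows at most by the number of
steps times a fixed polynomial bound. -/
theorem foldl_of_measure {l : α → List β} {s : α → σ} {f : α → σ → β → σ} (hl : PolyTime l)
    (hs : PolyTime s) (hf : PolyTime fun x : α × σ × β => f x.1 x.2.1 x.2.2) (μ : σ → ℕ)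
    (P Q R : Polynomial ℕ) (hP : ∀ y, size y ≤ P.eval (μ y)) (hQ : ∀ x, μ (s x) ≤ Q.eval (size x))
    (hR : ∀ x y b, μ (f x y b) ≤ μ y + R.eval (size x + size b)) :
    PolyTime fun x => (l x).foldl (f x) (s x) := by
  obtain ⟨T, hT⟩ := hl.size_le
  -- `T` bounds the size of the list, hence both its length and the size of its elements.
  refine foldl hl hs hf (P.comp (Q + T * R.comp (.X + T))) fun x i => (hP _).trans ?_
  rw [Polynomial.eval_comp]
  refine eval_mono P ?_
  simp only [Polynomial.eval_add, Polynomial.eval_mul, Polynomial.eval_X, Polynomial.eval_comp]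
  have key : ∀ (l' : List β) (y : σ), (∀ b ∈ l', size b ≤ T.eval (size x)) →
      μ (l'.foldl (f x) y) ≤ μ y + l'.length * R.eval (size x + T.eval (size x)) := by
    intro l'
    induction l' with
    | nil => simp
    | cons b l' ih =>
      intro y h
      rw [List.forall_mem_cons] at h
      have h₁ := ih (f x y b) h.2
      have h₂ := (hR x y b).trans (Nat.add_le_add_left (eval_mono R
        (Nat.add_le_add_left h.1 (size x))) _)
      rw [List.foldl_cons, List.length_cons, Nat.add_one_mul]
      omega
  have h₁ := key ((l x).take i) (s x) fun b hb =>
    (size_le_of_mem (List.mem_of_mem_take hb)).le.trans (hT x)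
  have h₂ : ((l x).take i).length ≤ T.eval (size x) :=
    (List.length_take_le' i _).trans ((length_le_size _).trans (hT x))
  exact h₁.trans (Nat.add_le_add (hQ x) (Nat.mul_le_mul_right _ h₂))

/-- Folding with a function that increases the size of the accumulator only by a bounded amount. -/
theorem foldl_of_growth {l : α → List β} {s : α → σ} {f : α → σ → β → σ} (hl : PolyTime l)
    (hs : PolyTime s) (hf : PolyTime fun x : α × σ × β => f x.1 x.2.1 x.2.2) (R : Polynomial ℕ)
    (hR : ∀ x y b, size (f x y b) ≤ size y + R.eval (size x + size b)) :
    PolyTime fun x => (l x).foldl (f x) (s x) :=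
  let ⟨Q, hQ⟩ := hs.size_le
  foldl_of_measure hl hs hf size .X Q R (by simp) hQ hR

@[fun_prop]
theorem and {f g : α → Bool} (hf : PolyTime f) (hg : PolyTime g) :
    PolyTime fun x => f x && g x := by
  convert hf.ite hg (const false) using 2 with x
  cases f x <;> rfl

@[fun_prop]
theorem or {f g : α → Bool} (hf : PolyTime f) (hg : PolyTime g) :
    PolyTime fun x => f x || g x := by
  convert hf.ite (const true) hg using 2 with x
  cases f x <;> rfl

@[fun_prop]
theorem not {f : α → Bool} (hf : PolyTime f) : PolyTime fun x => !f x := by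
  convert hf.ite (const false) (const true) using 2 with x
  cases f x <;> rfl

@[fun_prop]
theorem xor {f g : α → Bool} (hf : PolyTime f) (hg : PolyTime g) :
    PolyTime fun x => f x ^^ g x := by
  convert hf.ite hg.not hg using 2 with x
  cases f x <;> simp

@[fun_prop]
theorem tail {l : α → List β} (hl : PolyTime l) : PolyTime fun x => (l x).tail := by
  have := listCases hl (f := fun _ => []) (g := fun _ _ l => l) (by fun_prop) (by fun_prop)
  convert this using 2 with x
  cases l x <;> rfl

@[fun_prop]
theorem headD {l : α → List β} {f : α → β} (hl : PolyTime l) (hf : PolyTime f) :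
    PolyTime fun x => (l x).headD (f x) := by
  have := listCases hl hf (g := fun _ b _ => b) (by fun_prop)
  convert this using 2 with x
  cases l x <;> rfl

@[fun_prop]
theorem isEmpty {l : α → List β} (hl : PolyTime l) : PolyTime fun x => (l x).isEmpty := by
  have := listCases hl (f := fun _ => true) (g := fun _ _ _ => false) (by fun_prop) (by fun_prop)
  convert this using 2 with x
  cases l x <;> rfl

@[fun_prop]
theorem reverse {l : α → List β} (hl : PolyTime l) : PolyTime fun x => (l x).reverse := by
  have := foldl_of_growth hl (s := fun _ => []) (f := fun _ l b => b :: l) (by fun_prop)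
    (by fun_prop) (.X + 1) (by intro x y b; simp; omega)
  simpa [List.foldl_flip_cons_eq_append'] using this

theorem map {l : α → List β} {f : α → β → γ} (hl : PolyTime l)
    (hf : PolyTime fun x : α × β => f x.1 x.2) : PolyTime fun x => (l x).map (f x) := by
  obtain ⟨P, hP⟩ := hf.size_le
  have := foldl_of_growth hl (s := fun _ => []) (f := fun x l b => f x b :: l) (by fun_prop)
    (cons (hf.comp (f := fun x : α × List γ × β => (x.1, x.2.2)) (by fun_prop)) (by fun_prop))
    (P.comp (.X + 1) + 1) (by
      intro x y b
      have := hP (x, b)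
      simp at *
      omega)
  convert this.reverse using 2 with x
  simp

theorem all {l : α → List β} {f : α → β → Bool} (hl : PolyTime l)
    (hf : PolyTime fun x : α × β => f x.1 x.2) : PolyTime fun x => (l x).all (f x) := by
  have := foldl_of_growth hl (s := fun _ => true) (f := fun x c b => c && f x b) (by fun_prop)
    (and (by fun_prop) (hf.comp (f := fun x : α × Bool × β => (x.1, x.2.2)) (by fun_prop)))
    3 (by
      intro x y b
      have := size_bool_le (y && f x b)
      simp at *
      omega)
  convert this using 2 with x
  suffices h : ∀ (l : List β) (c : Bool),
      l.foldl (fun c b => c && f x b) c = (c && l.all (f x)) by simp [h]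
  intro l
  induction l with
  | nil => simp
  | cons b l ih => simp [ih, Bool.and_assoc]

theorem filter {l : α → List β} {f : α → β → Bool} (hl : PolyTime l)
    (hf : PolyTime fun x : α × β => f x.1 x.2) : PolyTime fun x => (l x).filter (f x) := by
  have := foldl_of_growth hl (s := fun _ => [])
    (f := fun x l b => if f x b = true then b :: l else l) (by fun_prop)
    (PolyTime.ite (hf.comp (f := fun x : α × List β × β => (x.1, x.2.2)) (by fun_prop))
      (by fun_prop) (by fun_prop))
    (.X + 1) (by
      intro x y b
      split <;> simp
      omega)
  convert this.reverse using 2 with x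
  suffices h : ∀ l l' : List β, l.foldl (fun l b => if f x b = true then b :: l else l) l' =
      (l.filter (f x)).reverse ++ l' by simp [h]
  intro l
  induction l with
  | nil => simp
  | cons b l ih => intro l'; cases h : f x b <;> simp [ih, h]

theorem zip {l : α → List β} {l' : α → List γ} (hl : PolyTime l) (hl' : PolyTime l') :
    PolyTime fun x => (l x).zip (l' x) := by
  have := foldl_of_growth hl (s := fun x => (l' x, ([] : List (β × γ))))
    (f := fun _ s b => match s.1 with
      | [] => s
      | c :: t => (t, (b, c) :: s.2)) (by fun_prop)
    (listCases (l := fun x : α × (List γ × List (β × γ)) × β => x.2.1.1)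
      (f := fun x => x.2.1) (g := fun x c t => (t, (x.2.2, c) :: x.2.1.2))
      (by fun_prop) (by fun_prop) (by fun_prop))
    (.X + 2) (by
      rintro x ⟨_ | ⟨c, t⟩, l⟩ b <;> simp
      omega)
  convert this.snd.reverse using 2 with x
  generalize l x = l, l' x = l'
  suffices h : ∀ (l : List β) (l' : List γ) (l'' : List (β × γ)),
      (l.foldl (fun (s : List γ × List (β × γ)) b => match s.1 with
        | [] => s
        | c :: t => (t, (b, c) :: s.2)) (l', l'')).2 = (l.zip l').reverse ++ l'' by simp [h]
  intro l
  induction l with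
  | nil => simp
  | cons b l ih => rintro (_ | ⟨c, l'⟩) l'' <;> simp [ih]

end PolyTime

end

section

variable {α β γ : Type} [Enc α] [Enc β] [Enc γ]

/-! ### Equality -/

/-- A type on which equality is decidable in polynomial time. -/
class PolyTimeEq (α : Type) [Enc α] [DecidableEq α] : Prop where
  polyTime_eq : PolyTime fun x : α × α => decide (x.1 = x.2)

@[fun_prop]
theorem PolyTime.eq [DecidableEq β] [PolyTimeEq β] {f g : α → β} (hf : PolyTime f)
    (hg : PolyTime g) : PolyTime fun x => decide (f x = g x) :=
  PolyTimeEq.polyTime_eq.comp (hf.pair hg)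

instance : PolyTimeEq Bool where
  polyTime_eq := by
    have : PolyTime fun x : Bool × Bool => !(x.1 ^^ x.2) := by fun_prop
    convert this using 2 with x
    rcases x with ⟨_ | _, _ | _⟩ <;> rfl

/-- A fold over the first list consumes the second. If the second runs out early the verdict becomes
false; if it is longer, the final emptiness test fails. -/
instance [DecidableEq β] [PolyTimeEq β] : PolyTimeEq (List β) where
  polyTime_eq := by
    have := PolyTime.foldl_of_growth (l := fun x : List β × List β => x.1)
      (s := fun x => (x.2, true))
      (f := fun _ s b => match s.1 with
        | [] => ([], false)
        | c :: t => (t, s.2 && decide (b = c))) (by fun_prop) (by fun_prop)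
      (PolyTime.listCases (l := fun x : (List β × List β) × (List β × Bool) × β => x.2.1.1)
        (f := fun x => ([], false)) (g := fun x c t => (t, x.2.1.2 && decide (x.2.2 = c)))
        (by fun_prop) (by fun_prop) (by fun_prop)) 4 (by
          rintro x ⟨_ | ⟨c, t⟩, r⟩ b
          · simp +arith
          · have := size_bool_le (r && decide (b = c))
            simp only [size_pair, size_cons, Polynomial.eval_ofNat]
            omega)
    convert this.snd.and this.fst.isEmpty using 2 with x
    obtain ⟨l, l'⟩ := x
    suffices h : ∀ (l l' : List β) (r : Bool),
        ((l.foldl (fun (s : List β × Bool) b => match s.1 with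
          | [] => ([], false)
          | c :: t => (t, s.2 && decide (b = c))) (l', r)).2 &&
        (l.foldl (fun (s : List β × Bool) b => match s.1 with
          | [] => ([], false)
          | c :: t => (t, s.2 && decide (b = c))) (l', r)).1.isEmpty) = (r && decide (l = l')) by
      simpa using (h l l' true).symm
    intro l
    induction l with
    | nil => rintro (_ | ⟨c, l'⟩) r <;> simp
    | cons b l ih =>
      rintro (_ | ⟨c, l'⟩) r
      · simp only [List.foldl_cons, ih]
        simp
      · simp only [List.foldl_cons, ih]
        simp [Bool.and_assoc]

/-! ### Natural numbers in binary -/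

/-- The value of a binary numeral, least significant digit first. -/
def val : List Bool → ℕ
  | [] => 0
  | b :: l => b.toNat + 2 * val l

theorem val_append (l l' : List Bool) : val (l ++ l') = val l + 2 ^ l.length * val l' := by
  induction l with
  | nil => simp [val]
  | cons b l ih => simp [val, ih, pow_succ]; ring

theorem val_encodeNat (n : ℕ) : val (encodeNat n) = n := by
  have h : ∀ p : PosNum, val (encodePosNum p) = p := by
    intro p
    induction p with
    | one => rfl
    | bit0 p ih => simp [encodePosNum, val, ih]; ring
    | bit1 p ih => simp [encodePosNum, val, ih]; ring
  have h' : ∀ m : Num, val (encodeNum m) = m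
    | .zero => rfl
    | .pos p => h p
  rw [encodeNat, h', Num.to_of_nat]

theorem encodeNat_injective : Function.Injective encodeNat :=
  Function.LeftInverse.injective (g := val) val_encodeNat

theorem size_le_length (l : List Bool) : size l ≤ 4 * l.length + 1 := by
  induction l with
  | nil => simp
  | cons b l ih =>
    have := size_bool_le b
    simp
    omega

/-- A step of an addition: `s` holds the remaining digits of both summands, the carry, and the
digits of the sum found so far, in reverse order. -/
def addStep (s : List Bool × List Bool × Bool × List Bool) :
    List Bool × List Bool × Bool × List Bool :=
  (s.1.tail, s.2.1.tail,
    (s.1.headD false && s.2.1.headD false) ||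
      (s.2.2.1 && (s.1.headD false || s.2.1.headD false)),
    (s.1.headD false ^^ s.2.1.headD false ^^ s.2.2.1) :: s.2.2.2)

/-- The digits of `a` serve as a clock for the first fold, and what is left of `b` for the second,
so both summands get used up. -/
def addLoop (a b : List Bool) : List Bool × List Bool × Bool × List Bool :=
  let s := a.foldl (fun s _ => addStep s) (a, b, false, [])
  s.2.1.foldl (fun s _ => addStep s) s

def add (a b : List Bool) : List Bool :=
  ((addLoop a b).2.2.1 :: (addLoop a b).2.2.2).reverse

/-- The invariant of the addition: the digits found so far, plus the carry and the remaining digits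
at their place value. -/
def addValue (s : List Bool × List Bool × Bool × List Bool) : ℕ :=
  val s.2.2.2.reverse + 2 ^ s.2.2.2.length * (s.2.2.1.toNat + val s.1 + val s.2.1)

theorem val_eq_headD_tail (l : List Bool) : val l = (l.headD false).toNat + 2 * val l.tail := by
  cases l <;> simp [val]

theorem addValue_addStep (s : List Bool × List Bool × Bool × List Bool) :
    addValue (addStep s) = addValue s := by
  obtain ⟨a, b, c, l⟩ := s
  simp only [addValue, addStep, List.reverse_cons, val_append, List.length_reverse,
    List.length_cons, pow_succ, val_eq_headD_tail a, val_eq_headD_tail b]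
  generalize a.headD false = x, b.headD false = y
  cases x <;> cases y <;> cases c <;> simp [val] <;> ring

theorem foldl_addStep (l : List Bool) (s : List Bool × List Bool × Bool × List Bool) :
    addValue (l.foldl (fun s _ => addStep s) s) = addValue s ∧
    (l.foldl (fun s _ => addStep s) s).1 = s.1.drop l.length ∧
    (l.foldl (fun s _ => addStep s) s).2.1 = s.2.1.drop l.length ∧
    (l.foldl (fun s _ => addStep s) s).2.2.2.length = l.length + s.2.2.2.length := by
  induction l generalizing s with
  | nil => simp
  | cons b l ih =>
    have := ih (addStep s)
    rw [addValue_addStep] at this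
    simp only [List.foldl_cons, this, true_and]
    simp [addStep]
    omega

theorem val_add (a b : List Bool) : val (add a b) = val a + val b := by
  have h₁ := foldl_addStep a (a, b, false, [])
  set s := a.foldl (fun s _ => addStep s) (a, b, false, []) with hs
  have h₂ := foldl_addStep s.2.1 s
  have h₃ : addLoop a b = s.2.1.foldl (fun s _ => addStep s) s := rfl
  rw [← h₃] at h₂
  have h₄ : addValue (addLoop a b) = val a + val b := by
    rw [h₂.1, h₁.1]
    simp [addValue, val]
  rw [← h₄]
  have h₅ : (addLoop a b).1 = [] := by simp [h₂.2.1, h₁.2.1]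
  have h₆ : (addLoop a b).2.1 = [] := by simp [h₂.2.2.1]
  simp [addValue, add, h₅, h₆, val_append, val]

theorem length_add (a b : List Bool) : (add a b).length = max a.length b.length + 1 := by
  have h₁ := foldl_addStep a (a, b, false, [])
  set s := a.foldl (fun s _ => addStep s) (a, b, false, []) with hs
  have h₂ := foldl_addStep s.2.1 s
  have h₃ : addLoop a b = s.2.1.foldl (fun s _ => addStep s) s := rfl
  rw [← h₃] at h₂
  simp [add, h₂.2.2.2, h₁.2.2]
  omega

theorem PolyTime.addStep {f : α → List Bool × List Bool × Bool × List Bool} (hf : PolyTime f) :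
    PolyTime fun x => addStep (f x) := by
  unfold StackMachine.addStep
  fun_prop

theorem size_addStep (s : List Bool × List Bool × Bool × List Bool) :
    size (addStep s) ≤ size s + 6 := by
  obtain ⟨a, b, c, l⟩ := s
  have h₁ := size_drop_le a 1
  have h₂ := size_drop_le b 1
  have h₃ := size_pos c
  simp only [StackMachine.addStep, size_pair, size_cons, List.drop_one] at *
  have h₄ := size_bool_le (a.headD false ^^ b.headD false ^^ c)
  have h₅ := size_bool_le ((a.headD false && b.headD false) ||
    (c && (a.headD false || b.headD false)))
  omega

@[fun_prop]
theorem PolyTime.add {f g : α → List Bool} (hf : PolyTime f) (hg : PolyTime g) :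
    PolyTime fun x => add (f x) (g x) := by
  have h₁ := PolyTime.foldl_of_growth hf (s := fun x => (f x, g x, false, ([] : List Bool)))
    (f := fun _ s _ => StackMachine.addStep s) (by fun_prop) (PolyTime.addStep (by fun_prop)) 6
    fun _ s _ => by simpa using size_addStep s
  have h₂ := PolyTime.foldl_of_growth h₁.snd.fst (s := fun x => _)
    (f := fun _ s _ => StackMachine.addStep s) h₁ (PolyTime.addStep (by fun_prop)) 6
    fun _ s _ => by simpa using size_addStep s
  exact (h₂.snd.snd.fst.cons h₂.snd.snd.snd).reverse

def mul : List Bool → List Bool → List Bool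
  | [], _ => []
  | x :: a, b => add (false :: mul a b) (if x = true then b else [])

theorem val_mul (a b : List Bool) : val (mul a b) = val a * val b := by
  induction a with
  | nil => simp [mul, val]
  | cons x a ih => cases x <;> simp [mul, val_add, val, ih] <;> ring

/-- The coefficient 1 of the second factor matters: a long accumulator in second place grows only
additively. -/
theorem length_mul_le (a b : List Bool) : (mul a b).length ≤ 2 * a.length + b.length := by
  induction a with
  | nil => simp [mul]
  | cons x a ih => cases x <;> simp [mul, length_add] <;> omega

theorem mul_eq_foldl (a b : List Bool) : mul a b =
    a.reverse.foldl (fun l x => add (false :: l) (if x = true then b else [])) [] := by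
  rw [List.foldl_reverse]
  induction a with
  | nil => rfl
  | cons x a ih => rw [mul, ih]; rfl

@[fun_prop]
theorem PolyTime.mul {f g : α → List Bool} (hf : PolyTime f) (hg : PolyTime g) :
    PolyTime fun x => mul (f x) (g x) := by
  obtain ⟨P, hP⟩ := hg.size_le
  have := PolyTime.foldl_of_measure hf.reverse (s := fun x => ([] : List Bool))
    (f := fun x l c => StackMachine.add (false :: l) (if c = true then g x else []))
    (by fun_prop) (by
      refine PolyTime.add (by fun_prop) (PolyTime.ite (by fun_prop) ?_ (by fun_prop))
      exact hg.comp (by fun_prop)) List.length (4 * .X + 1) 0 (P.comp .X + 2)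
    (fun y => by simpa using size_le_length y) (by simp) (by
      intro x y b
      have h₁ := (length_le_size (g x)).trans (hP x)
      have h₂ := eval_mono P (Nat.le_add_right (size x) (size b))
      cases b <;> simp [length_add] at * <;> omega)
  simpa only [mul_eq_foldl] using this

/-- Digits come least significant first, so each differing pair overrides the verdict so far. A
nonzero digit left over in `b` decides for `b`. -/
def le (a b : List Bool) : Bool :=
  let s := a.foldl (fun s x => (s.1.tail, if x = s.1.headD false then s.2 else s.1.headD false))
    (b, true)
  s.2 || !s.1.all fun x => !x

theorem le_iff (a b : List Bool) : le a b = true ↔ val a ≤ val b := by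
  -- The verdict `r` on the lower digits acts as a carry: true turns the strict comparison into a
  -- weak one.
  suffices h : ∀ (a b : List Bool) (r : Bool),
      let s := a.foldl (fun (s : List Bool × Bool) x =>
        (s.1.tail, if x = s.1.headD false then s.2 else s.1.headD false)) (b, r)
      (s.2 || !s.1.all fun x => !x) = true ↔ val a < val b + r.toNat by
    exact (h a b true).trans Nat.lt_succ_iff
  intro a
  induction a with
  | nil =>
    intro b r
    have h : ∀ b : List Bool, (!b.all fun x => !x) = true ↔ 0 < val b := by
      intro b
      induction b with
      | nil => simp [val]
      | cons x b ih => cases x <;> simp [val] at *; exact ih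
    simp only [List.foldl_nil, Bool.or_eq_true, h]
    cases r <;> simp [val]
  | cons x a ih =>
    intro b r
    simp only [List.foldl_cons]
    refine (ih _ _).trans ?_
    rw [val_eq_headD_tail b, val]
    generalize b.headD false = y
    cases x <;> cases y <;> cases r <;> simp <;> omega

@[fun_prop]
theorem PolyTime.le {f g : α → List Bool} (hf : PolyTime f) (hg : PolyTime g) :
    PolyTime fun x => le (f x) (g x) := by
  have := PolyTime.foldl_of_growth hf (s := fun x => (g x, true))
    (f := fun _ s x => (s.1.tail, if x = s.1.headD false then s.2 else s.1.headD false))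
    (by fun_prop) (by
      have : PolyTime fun x : α × (List Bool × Bool) × Bool => (x.2.1.1.tail,
          if decide (x.2.2 = x.2.1.1.headD false) = true then x.2.1.2
            else x.2.1.1.headD false) := by fun_prop
      simpa only [decide_eq_true_eq] using this) 3 (by
      rintro x ⟨l, r⟩ b
      have h₁ := size_drop_le l 1
      have h₂ := size_bool_le (if b = l.headD false then r else l.headD false)
      simp only [size_pair, List.drop_one, Polynomial.eval_ofNat] at *
      omega)
  exact this.snd.or (this.fst.all (f := fun _ x => !x) (by fun_prop)).not

/-! ### Rational numbers -/

/-- The triple `(x, y, d)` stands for the rational number `(x - y) / d`. -/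
abbrev Frac : Type := List Bool × List Bool × List Bool

namespace Frac

def val (q : Frac) : ℚ :=
  ((StackMachine.val q.1 : ℚ) - StackMachine.val q.2.1) / StackMachine.val q.2.2

def Valid (q : Frac) : Prop := StackMachine.val q.2.2 ≠ 0

def zero : Frac := ([], [], [true])

/-- No common factors are cancelled. Every product has its factor from `r` first, so that by
`length_mul_le` the length of `q` enters the bound with coefficient 1. -/
def add (q r : Frac) : Frac :=
  (StackMachine.add (StackMachine.mul r.1 q.2.2) (StackMachine.mul r.2.2 q.1),
    StackMachine.add (StackMachine.mul r.2.1 q.2.2) (StackMachine.mul r.2.2 q.2.1),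
    StackMachine.mul r.2.2 q.2.2)

def mul (q r : Frac) : Frac :=
  (StackMachine.add (StackMachine.mul q.1 r.1) (StackMachine.mul q.2.1 r.2.1),
    StackMachine.add (StackMachine.mul q.1 r.2.1) (StackMachine.mul q.2.1 r.1),
    StackMachine.mul q.2.2 r.2.2)

/-- Cross-multiplication, with the subtracted parts moved to the other side, leaves a comparison of
natural numbers. -/
def le (q r : Frac) : Bool :=
  StackMachine.le (StackMachine.add (StackMachine.mul q.1 r.2.2) (StackMachine.mul r.2.1 q.2.2))
    (StackMachine.add (StackMachine.mul r.1 q.2.2) (StackMachine.mul q.2.1 r.2.2))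

theorem valid_zero : zero.Valid := by simp [Valid, zero, StackMachine.val]

theorem val_zero : zero.val = 0 := by simp [val, zero, StackMachine.val]

theorem Valid.add {q r : Frac} (hq : q.Valid) (hr : r.Valid) : (q.add r).Valid := by
  simp_all [Valid, Frac.add, val_mul]

theorem Valid.mul {q r : Frac} (hq : q.Valid) (hr : r.Valid) : (q.mul r).Valid := by
  simp_all [Valid, Frac.mul, val_mul]

theorem val_add {q r : Frac} (hq : q.Valid) (hr : r.Valid) : (q.add r).val = q.val + r.val := by
  have hq' : (StackMachine.val q.2.2 : ℚ) ≠ 0 := Nat.cast_ne_zero.2 hq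
  have hr' : (StackMachine.val r.2.2 : ℚ) ≠ 0 := Nat.cast_ne_zero.2 hr
  simp only [val, add, val_mul, StackMachine.val_add, Nat.cast_add, Nat.cast_mul]
  field_simp
  ring

theorem val_mul (q r : Frac) : (q.mul r).val = q.val * r.val := by
  simp only [val, mul, StackMachine.val_mul, StackMachine.val_add, Nat.cast_add, Nat.cast_mul]
  rw [div_mul_div_comm]
  ring

theorem le_iff {q r : Frac} (hq : q.Valid) (hr : r.Valid) : q.le r = true ↔ q.val ≤ r.val := by
  have hq' : (0 : ℚ) < StackMachine.val q.2.2 := Nat.cast_pos.2 (Nat.pos_of_ne_zero hq)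
  have hr' : (0 : ℚ) < StackMachine.val r.2.2 := Nat.cast_pos.2 (Nat.pos_of_ne_zero hr)
  rw [le, StackMachine.le_iff, val, val, div_le_div_iff₀ hq' hr']
  simp only [StackMachine.val_mul, StackMachine.val_add]
  rw [← Nat.cast_le (α := ℚ)]
  push_cast
  constructor <;> intro h <;> linarith

/-- The largest number of digits in a fraction. -/
def length (q : Frac) : ℕ := max q.1.length (max q.2.1.length q.2.2.length)

theorem length_add_le (q r : Frac) : (q.add r).length ≤ q.length + 2 * r.length + 1 := by
  have h₁ := length_mul_le r.1 q.2.2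
  have h₂ := length_mul_le r.2.2 q.1
  have h₃ := length_mul_le r.2.1 q.2.2
  have h₄ := length_mul_le r.2.2 q.2.1
  have h₅ := length_mul_le r.2.2 q.2.2
  simp only [length, add, length_add]
  omega

theorem length_le_size (q : Frac) : q.length ≤ size q := by
  obtain ⟨x, y, d⟩ := q
  have h₁ := StackMachine.length_le_size x
  have h₂ := StackMachine.length_le_size y
  have h₃ := StackMachine.length_le_size d
  simp [length]
  omega

theorem size_le (q : Frac) : size q ≤ 12 * q.length + 5 := by
  obtain ⟨x, y, d⟩ := q
  have h₁ := size_le_length x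
  have h₂ := size_le_length y
  have h₃ := size_le_length d
  simp [length]
  omega

end Frac

@[fun_prop]
theorem PolyTime.frac_add {f g : α → Frac} (hf : PolyTime f) (hg : PolyTime g) :
    PolyTime fun x => (f x).add (g x) := by
  unfold Frac.add
  fun_prop

@[fun_prop]
theorem PolyTime.frac_mul {f g : α → Frac} (hf : PolyTime f) (hg : PolyTime g) :
    PolyTime fun x => (f x).mul (g x) := by
  unfold Frac.mul
  fun_prop

@[fun_prop]
theorem PolyTime.frac_le {f g : α → Frac} (hf : PolyTime f) (hg : PolyTime g) :
    PolyTime fun x => (f x).le (g x) := by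
  unfold Frac.le
  fun_prop

end

section

variable {α β γ : Type} [Enc α] [Enc β] [Enc γ]

/-! ### Parsing -/

/-- Input symbols as lists of bits. Brackets are not distinguished. -/
def token : Γ' → List Bool
  | .blank => [false, false]
  | .bit b => [b]
  | .bra => []
  | .ket => []
  | .comma => [true, false]

/-- The part of the input between two brackets: a list of fields, each of which is a list of words,
separated by blanks. -/
abbrev Segment : Type := List (List (List Bool))

/-- Apply `f` to the first list. -/
def onHead (f : List α → List α) (l : List (List α)) : List (List α) :=
  f (l.headD []) :: l.tail

/-- Extend the parsed part of the input by the token in front of it. -/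
def parseStep (c : List Bool) (s : List Segment) : List Segment :=
  -- The input is read from the right, so the comma that terminates a field opens it here, and a
  -- blank opens the word to its left.
  match c with
  | [] => [] :: s
  | b :: t =>
    if t.isEmpty = true then onHead (onHead (onHead fun l => b :: l)) s
    else if b = true then onHead (fun l => [[]] :: l) s
    else onHead (onHead fun l => [] :: l) s

/-- Parse a list of tokens, given in reverse order. -/
def parse (l : List (List Bool)) : List Segment :=
  l.foldl (fun s c => parseStep c s) [[]]

theorem size_onHead_le {f : List α → List α} {k : ℕ} (h : ∀ l, size (f l) ≤ size l + k)
    (l : List (List α)) : size (onHead f l) ≤ size l + (k + 2) := by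
  cases l with
  | nil =>
    have := h []
    simp [onHead] at *
    omega
  | cons x l =>
    have := h x
    simp [onHead] at *
    omega

theorem size_parseStep_le (c : List Bool) (s : List Segment) :
    size (parseStep c s) ≤ size s + 10 := by
  rcases c with _ | ⟨b, t⟩
  · simp [parseStep]
    omega
  · have h₁ := size_onHead_le (size_onHead_le (size_onHead_le (f := fun l => b :: l) (k := 4)
      fun l => by have := size_bool_le b; simp; omega)) s
    have h₂ := size_onHead_le (α := List (List Bool)) (f := fun l => [[]] :: l) (k := 4)
      (fun l => by simp; omega) s
    have h₃ := size_onHead_le (size_onHead_le (α := List Bool) (f := fun l => [] :: l) (k := 2)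
      fun l => by simp; omega) s
    rw [parseStep]
    split_ifs <;> omega

theorem polyTime_parse : PolyTime parse := by
  refine PolyTime.foldl_of_growth (f := fun _ s c => parseStep c s) PolyTime.id
    (PolyTime.const [[]]) ?_ 10 fun _ s c => by simpa using size_parseStep_le c s
  have := PolyTime.listCases (l := fun x : List (List Bool) × List Segment × List Bool => x.2.2)
    (f := fun x => [] :: x.2.1) (g := fun x b t =>
      if t.isEmpty = true then onHead (onHead (onHead fun l => b :: l)) x.2.1
      else if b = true then onHead (fun l => [[]] :: l) x.2.1
      else onHead (onHead fun l => [] :: l) x.2.1)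
    (by fun_prop) (by fun_prop) (by unfold onHead; fun_prop)
  convert this using 2 with x
  cases x.2.2 <;> rfl

/-- The segments holding the coordinates, the probability and the utilities of a state. -/
abbrev RawRow : Type := Segment × Segment × Segment

/-- A table row yields six segments, of which the first two and the last are gaps between brackets.
A single remaining segment is the end of the table and is left alone. -/
def groupStep (s : List Segment × List RawRow) : List Segment × List RawRow :=
  match s.1.tail with
  | [] => s
  | _ :: t => (t.tail.tail.tail.tail, (t.headD [], t.tail.headD [], t.tail.tail.headD []) :: s.2)

/-- Extract the rows from the segments of the table. -/
def group (l : List Segment) : List RawRow :=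
  -- The list is its own clock: it has at least as many segments as rows, and surplus steps change
  -- nothing.
  (l.foldl (fun s _ => groupStep s) (l, [])).2.reverse

theorem size_tail_le (l : List α) : size l.tail ≤ size l := by
  simpa using size_drop_le l 1

theorem size_headD_nil_add_size_tail_le (l : List (List α)) :
    size (l.headD []) + size l.tail ≤ size l + 1 := by
  cases l <;> simp +arith

theorem size_groupStep_le (s : List Segment × List RawRow) :
    size (groupStep s) ≤ size s + 6 := by
  obtain ⟨l, r⟩ := s
  have h₁ := size_tail_le l
  rw [groupStep]
  split
  · omega
  · next x t h =>
    simp only at h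
    have h₂ := size_headD_nil_add_size_tail_le t
    have h₃ := size_headD_nil_add_size_tail_le t.tail
    have h₄ := size_headD_nil_add_size_tail_le t.tail.tail
    have h₅ := size_tail_le t.tail.tail.tail
    simp only [h, size_cons, size_pair] at *
    omega

theorem PolyTime.group {l : α → List Segment} (hl : PolyTime l) :
    PolyTime fun x => group (l x) := by
  have := PolyTime.foldl_of_growth hl (s := fun x => (l x, ([] : List RawRow)))
    (f := fun _ s _ => groupStep s) (by fun_prop) (by
      have := PolyTime.listCases (l := fun x : α × (List Segment × List RawRow) × Segment =>
          x.2.1.1.tail) (f := fun x => x.2.1)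
        (g := fun x _ t => (t.tail.tail.tail.tail,
          (t.headD [], t.tail.headD [], t.tail.tail.headD []) :: x.2.1.2))
        (by fun_prop) (by fun_prop) (by fun_prop)
      convert this using 2 with x
      rw [groupStep]
      cases x.2.1.1.tail <;> rfl) 6
    fun _ s _ => by simpa using size_groupStep_le s
  exact this.snd.reverse

/-- Erase the coordinates that are not selected. -/
def mask (l : List Bool) (c : Segment) : Segment :=
  (l.zip c).map fun x => if x.1 = true then x.2 else []

/-- Read a rational number: a word consisting of the sign and the numerator, and a word for the
denominator. -/
def toFrac (f : List (List Bool)) : Frac :=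
  if (f.headD []).headD false = true then ([], (f.headD []).tail, f.tail.headD [])
  else ((f.headD []).tail, [], f.tail.headD [])

/-- The selected coordinates, the probability and the utilities of a state. -/
abbrev Row : Type := Segment × Frac × List Frac

def toRow (l : List Bool) (r : RawRow) : Row :=
  (mask l r.1, toFrac (r.2.1.headD []), r.2.2.map toFrac)

/-- The four segments in front of the table are the number of actions, the sizes, the gap between
two brackets, and the indicator vector. The first two are not needed, as the table determines them
wherever they matter. -/
def rows (l : List Segment) : List Row :=
  (group l.tail.tail.tail.tail).map (toRow ((l.tail.tail.tail.headD []).headD [] |>.headD []))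

@[fun_prop]
theorem PolyTime.toFrac {f : α → List (List Bool)} (hf : PolyTime f) :
    PolyTime fun x => toFrac (f x) := by
  unfold StackMachine.toFrac
  fun_prop

@[fun_prop]
theorem PolyTime.mask {f : α → List Bool} {g : α → Segment} (hf : PolyTime f) (hg : PolyTime g) :
    PolyTime fun x => mask (f x) (g x) := by
  unfold StackMachine.mask
  exact (hf.zip hg).map (f := fun _ x => if x.1 = true then x.2 else []) (by fun_prop)

theorem polyTime_rows : PolyTime rows := by
  refine PolyTime.map (PolyTime.group (by fun_prop)) (f := fun l => toRow _) ?_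
  unfold toRow
  refine PolyTime.pair (by fun_prop) (PolyTime.pair (by fun_prop) ?_)
  exact PolyTime.map (by fun_prop) (f := fun _ x => StackMachine.toFrac x) (by fun_prop)

/-! ### The decision procedure -/

def addVec (v w : List Frac) : List Frac :=
  (v.zip w).map fun x => x.1.add x.2

def scale (q : Frac) (v : List Frac) : List Frac :=
  v.map fun x => q.mul x

/-- The sums of the utilities, weighted with the probabilities, over a list of states. -/
def totals (v : List Frac) (l : List Row) : List Frac :=
  l.foldl (fun w r => addVec w (scale r.2.1 r.2.2)) (v.map fun _ => Frac.zero)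

/-- The indicator vector of the maximal entries. -/
def maximal (v : List Frac) : List Bool :=
  v.map fun x => v.all fun y => y.le x

def checkNull (v : List Frac) : NullFiberRule → Bool
  | .ignore => true
  | .reject => false
  | .allOptimal => (maximal v).all fun x => x

/-- Normalization is avoided: a fiber is null when none of its probabilities is positive, and
otherwise unnormalized sums have the same maximizers as conditional expectations. -/
def checkRow (rule : NullFiberRule) (l : List Row) (r : Row) : Bool :=
  if ((l.filter fun s => decide (s.1 = r.1)).all fun s => s.2.1.le Frac.zero) = true then
    checkNull r.2.2 rule
  else
    decide (maximal (totals r.2.2 (l.filter fun s => decide (s.1 = r.1))) = maximal r.2.2)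

def check (rule : NullFiberRule) (l : List Row) : Bool :=
  l.all (checkRow rule l)

/-- The total number of digits in a vector. -/
def vecLength (v : List Frac) : ℕ := (v.map fun q => q.length + 1).sum

/-- The coefficient 1 of `vecLength v` is what `PolyTime.foldl_of_measure` requires in
`PolyTime.totals`. -/
theorem vecLength_addVec_le (v w : List Frac) :
    vecLength (addVec v w) ≤ vecLength v + 2 * size w := by
  induction v generalizing w with
  | nil => simp [addVec, vecLength]
  | cons q v ih =>
    cases w with
    | nil => simp [addVec, vecLength]
    | cons r w =>
      have h₁ := ih w
      have h₂ := Frac.length_add_le q r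
      have h₃ := Frac.length_le_size r
      simp only [addVec, vecLength, List.zip_cons_cons, List.map_cons, List.sum_cons,
        size_cons] at *
      omega

theorem size_le_vecLength (v : List Frac) : size v ≤ 12 * vecLength v + 1 := by
  induction v with
  | nil => simp
  | cons q v ih =>
    have := Frac.size_le q
    simp only [vecLength, List.map_cons, List.sum_cons, size_cons] at *
    omega

@[fun_prop]
theorem PolyTime.scale {f : α → Frac} {g : α → List Frac} (hf : PolyTime f) (hg : PolyTime g) :
    PolyTime fun x => scale (f x) (g x) := by
  unfold StackMachine.scale
  exact hg.map (f := fun x y => (f x).mul y)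
    (PolyTime.frac_mul (hf.comp PolyTime.fst_prod) (by fun_prop))

@[fun_prop]
theorem PolyTime.addVec {f g : α → List Frac} (hf : PolyTime f) (hg : PolyTime g) :
    PolyTime fun x => addVec (f x) (g x) := by
  unfold StackMachine.addVec
  exact (hf.zip hg).map (f := fun _ x => x.1.add x.2) (by fun_prop)

@[fun_prop]
theorem PolyTime.totals {f : α → List Frac} {g : α → List Row} (hf : PolyTime f)
    (hg : PolyTime g) : PolyTime fun x => totals (f x) (g x) := by
  have h : PolyTime fun r : Row => StackMachine.scale r.2.1 r.2.2 := by fun_prop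
  obtain ⟨P, hP⟩ := h.size_le
  have hs : PolyTime fun x => (f x).map fun _ => Frac.zero :=
    hf.map (f := fun _ _ => Frac.zero) (by fun_prop)
  obtain ⟨Q, hQ⟩ := hs.size_le
  have hv : ∀ v, vecLength v ≤ size v := by
    intro v
    induction v with
    | nil => simp [vecLength]
    | cons q v ih =>
      have := Frac.length_le_size q
      simp only [vecLength, List.map_cons, List.sum_cons, size_cons] at *
      omega
  have h' : ∀ (x : α) (w : List Frac) (r : Row),
      vecLength (StackMachine.addVec w (StackMachine.scale r.2.1 r.2.2)) ≤
        vecLength w + (2 * P).eval (size x + size r) := by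
    intro x w r
    have h₁ := vecLength_addVec_le w (StackMachine.scale r.2.1 r.2.2)
    have h₂ := (hP r).trans (eval_mono P (Nat.le_add_left (size r) (size x)))
    simp only [Polynomial.eval_mul, Polynomial.eval_ofNat]
    omega
  have := PolyTime.foldl_of_measure hg hs
    (f := fun _ w r => StackMachine.addVec w (StackMachine.scale r.2.1 r.2.2)) (by fun_prop)
    vecLength (12 * .X + 1) Q (2 * P) (fun v => by simpa using size_le_vecLength v)
    (fun x => (hv _).trans (hQ x)) h'
  exact this

@[fun_prop]
theorem PolyTime.maximal {f : α → List Frac} (hf : PolyTime f) :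
    PolyTime fun x => maximal (f x) := by
  refine hf.map (f := fun x q => (f x).all fun y => y.le q) ?_
  exact PolyTime.all (l := fun x : α × Frac => f x.1) (f := fun x y => y.le x.2)
    (hf.comp PolyTime.fst_prod) (by fun_prop)

theorem PolyTime.checkNull {f : α → List Frac} (hf : PolyTime f) (rule : NullFiberRule) :
    PolyTime fun x => checkNull (f x) rule :=
  match rule with
  | .ignore => PolyTime.const true
  | .reject => PolyTime.const false
  | .allOptimal => hf.maximal.all (f := fun _ x => x) (by fun_prop)

theorem polyTime_check (rule : NullFiberRule) : PolyTime (check rule) := by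
  refine PolyTime.all (l := fun l : List Row => l) (f := checkRow rule) PolyTime.id ?_
  have h : PolyTime fun x : List Row × Row => x.1.filter fun s => decide (s.1 = x.2.1) :=
    PolyTime.filter (l := fun x : List Row × Row => x.1)
      (f := fun x s => decide (s.1 = x.2.1)) (by fun_prop) (by fun_prop)
  have h₁ := h.all (f := fun _ s => s.2.1.le Frac.zero) (by fun_prop)
  have h₂ := PolyTime.totals (f := fun x : List Row × Row => x.2.2.2) (by fun_prop) h
  exact h₁.ite (PolyTime.checkNull (by fun_prop) rule) (h₂.maximal.eq (by fun_prop))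

end

/-! ### The parse of an encoded input -/

/-- Parse a word in front of an already parsed part of the input. -/
def parseWord (w : List Γ') (s : List Segment) : List Segment :=
  w.foldr (fun c s => parseStep (token c) s) s

theorem parse_reverse_map_token (w : List Γ') :
    parse (w.map token).reverse = parseWord w [[]] := by
  rw [parse, List.foldl_reverse, List.foldr_map]
  rfl

theorem parseWord_append (w w' : List Γ') (s : List Segment) :
    parseWord (w ++ w') s = parseWord w (parseWord w' s) :=
  List.foldr_append

theorem parseWord_cons (c : Γ') (w : List Γ') (s : List Segment) :
    parseWord (c :: w) s = parseStep (token c) (parseWord w s) := rfl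

theorem parseWord_bit (l m : List Bool) (f : List (List Bool)) (F : Segment)
    (s : List Segment) : parseWord (l.map Γ'.bit) (((m :: f) :: F) :: s) =
      (((l ++ m) :: f) :: F) :: s := by
  induction l with
  | nil => rfl
  | cons b l ih =>
    rw [List.map_cons, parseWord_cons, ih]
    rfl

/-- The indicator vector is not terminated by a comma; its last bit opens the field and the word,
and an empty vector leaves the segment empty. -/
theorem parseWord_bit_nil (l : List Bool) (s : List Segment) :
    parseWord (l.map Γ'.bit) ([] :: s) = (if l = [] then [] else [[l]]) :: s := by
  induction l with
  | nil => rfl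
  | cons b l ih =>
    rw [List.map_cons, parseWord_cons, ih]
    cases l <;> rfl

theorem parseWord_field (w : List Γ') (F : Segment) (s : List Segment) :
    parseWord (ExplicitState.field w) (F :: s) = parseWord w (([[]] :: F) :: s) := by
  rw [ExplicitState.field, parseWord_append]
  rfl

theorem parseWord_field_encNat (k : ℕ) (F : Segment) (s : List Segment) :
    parseWord (ExplicitState.field (ExplicitState.encNat k)) (F :: s) =
      ([encodeNat k] :: F) :: s := by
  rw [parseWord_field, ExplicitState.encNat, parseWord_bit, List.append_nil]

/-- The words representing a rational number. -/
def ratField (q : ℚ) : List (List Bool) :=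
  [decide (q < 0) :: encodeNat q.num.natAbs, encodeNat q.den]

theorem parseWord_field_encRat (q : ℚ) (F : Segment) (s : List Segment) :
    parseWord (ExplicitState.field (ExplicitState.encRat q)) (F :: s) =
      (ratField q :: F) :: s := by
  rw [parseWord_field, ExplicitState.encRat, List.cons_append, parseWord_cons, parseWord_append,
    parseWord_cons, ExplicitState.encNat, ExplicitState.encNat, parseWord_bit]
  have h : parseStep (token .blank) ((((encodeNat q.den ++ []) :: []) :: F) :: s) =
      (([] :: (encodeNat q.den ++ []) :: []) :: F) :: s := rfl
  rw [h, parseWord_bit, List.append_nil, List.append_nil]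
  rfl

theorem parseWord_flatMap_field {ι : Type} (g : ι → List Γ') (f : ι → List (List Bool))
    (h : ∀ i F s, parseWord (ExplicitState.field (g i)) (F :: s) = (f i :: F) :: s) (l : List ι)
    (F : Segment) (s : List Segment) :
    parseWord (l.flatMap fun i => ExplicitState.field (g i)) (F :: s) = (l.map f ++ F) :: s := by
  induction l with
  | nil => rfl
  | cons i l ih => rw [List.flatMap_cons, parseWord_append, ih, h, List.map_cons, List.cons_append]

theorem parseWord_bracket (w : List Γ') (s : List Segment) :
    parseWord (ExplicitState.bracket w) s = [] :: parseWord w ([] :: s) := by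
  rw [ExplicitState.bracket, List.cons_append, parseWord_cons, parseWord_append]
  rfl

variable (D : StochasticDecisionProblem)

/-- The segments of the table row of a state. -/
def rawRow (s : D.State) : RawRow :=
  ((List.finRange D.n).map fun i => [encodeNat (s i)], [ratField (D.P s)],
    (List.finRange D.numActions).map fun a => ratField (D.U a s))

theorem parseWord_encRow (s : D.State) (t : List Segment) :
    parseWord (ExplicitState.encRow D s) t = [] :: [] :: (rawRow D s).1 :: (rawRow D s).2.1 ::
      (rawRow D s).2.2 :: [] :: t := by
  rw [ExplicitState.encRow, parseWord_bracket, parseWord_append, parseWord_append,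
    parseWord_bracket, parseWord_bracket,
    parseWord_flatMap_field _ _ fun _ => parseWord_field_encRat _,
    parseWord_field_encRat, parseWord_flatMap_field _ _ fun _ => parseWord_field_encNat _]
  simp [rawRow]

/-- The segments of the table. -/
def tableSegments (l : List RawRow) : List Segment :=
  l.flatMap fun r => [[], [], r.1, r.2.1, r.2.2, []]

theorem parseWord_table (l : List D.State) (t : List Segment) :
    parseWord (l.flatMap (ExplicitState.encRow D)) t = tableSegments (l.map (rawRow D)) ++ t := by
  induction l with
  | nil => rfl
  | cons s l ih =>
    rw [List.flatMap_cons, parseWord_append, ih, parseWord_encRow]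
    rfl

theorem group_tableSegments (l : List RawRow) : group (tableSegments l ++ [[]]) = l := by
  -- The clock is separated from the segments, which shrink during the induction. The final `[[]]`
  -- is the segment the parser starts from.
  suffices h : ∀ (w : List Segment) (l m : List RawRow), l.length ≤ w.length →
      (w.foldl (fun s _ => groupStep s) (tableSegments l ++ [[]], m)).2 = l.reverse ++ m by
    rw [group, h]
    · simp
    · simp [tableSegments]
      omega
  intro w
  induction w with
  | nil => simp
  | cons x w ih =>
    rintro (_ | ⟨r, l⟩) m h
    · exact ih [] m (by simp)
    · rw [List.reverse_cons, List.append_assoc]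
      exact ih l (r :: m) (by simpa using h)

variable {D} in
/-- The rows which are obtained by parsing an encoded input. -/
def stateRow (I : Finset (Fin D.n)) (s : D.State) : Row :=
  toRow ((List.finRange D.n).map fun i => decide (i ∈ I)) (rawRow D s)

theorem rows_parse_encode (x : StochasticSufficiencyInput) :
    rows (parse ((ExplicitState.encode x).map token).reverse) =
      (ExplicitState.states x.1).map (stateRow x.2) := by
  obtain ⟨D, I⟩ := x
  have h : ((List.finRange D.n).map fun i => Γ'.bit (decide (i ∈ I))) =
      ((List.finRange D.n).map fun i => decide (i ∈ I)).map Γ'.bit := by simp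
  rw [parse_reverse_map_token, ExplicitState.encode, parseWord_append, parseWord_append,
    parseWord_append, parseWord_table, parseWord_bracket, parseWord_bracket, h, parseWord_bit_nil,
    parseWord_flatMap_field _ _ fun _ => parseWord_field_encNat _, parseWord_field_encNat]
  simp only [rows, List.tail_cons, List.headD_cons, group_tableSegments, List.map_map]
  congr 1
  funext s
  simp only [Function.comp, stateRow]
  congr 1
  -- Without coordinates there is no field to read, and the default values supply the empty
  -- indicator vector.
  split_ifs with h
  · simp [h]
  · rfl

/-! ### Correctness of the decision procedure -/

theorem toFrac_ratField (q : ℚ) : (toFrac (ratField q)).Valid ∧ (toFrac (ratField q)).val = q := by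
  have hd : (q.den : ℚ) ≠ 0 := Nat.cast_ne_zero.2 q.den_nz
  by_cases h : q < 0
  · have h' : ((q.num.natAbs : ℤ) : ℚ) = -q.num := by
      rw [Int.ofNat_natAbs_of_nonpos (Rat.num_neg.2 h).le, Int.cast_neg]
    simp only [toFrac, ratField, Frac.Valid, Frac.val, h, List.headD_cons, List.tail_cons,
      decide_true, if_true, val_encodeNat]
    refine ⟨q.den_nz, ?_⟩
    rw [← Int.cast_natCast q.num.natAbs, h']
    simp [val, Rat.num_div_den]
  · have h' : ((q.num.natAbs : ℤ) : ℚ) = q.num := by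
      rw [Int.natAbs_of_nonneg (Rat.num_nonneg.2 (not_lt.1 h))]
    simp only [toFrac, ratField, Frac.Valid, Frac.val, h, List.headD_cons, List.tail_cons,
      decide_false, Bool.false_eq_true, if_false, val_encodeNat]
    refine ⟨q.den_nz, ?_⟩
    rw [← Int.cast_natCast q.num.natAbs, h']
    simp [val, Rat.num_div_den]

section

variable {D} (I : Finset (Fin D.n))

/-- Erased coordinates agree trivially, and at the selected ones equal numerals mean equal values.
-/
theorem stateRow_fst_eq_iff (s s' : D.State) :
    (stateRow I s').1 = (stateRow I s).1 ↔ I.restrict s' = I.restrict s := by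
  simp only [stateRow, toRow, mask, rawRow, List.zip_map', List.map_map, List.map_inj_left,
    List.mem_finRange, Function.comp, forall_true_left, funext_iff, Finset.restrict, Subtype.forall]
  refine forall_congr' fun i => ?_
  by_cases h : i ∈ I
  · simp [h, encodeNat_injective.eq_iff, Fin.ext_iff]
  · simp [h]

theorem stateRow_prob (s : D.State) :
    (stateRow I s).2.1.Valid ∧ (stateRow I s).2.1.val = D.P s :=
  toFrac_ratField _

theorem stateRow_utilities (s : D.State) :
    (stateRow I s).2.2 = (List.finRange D.numActions).map fun a => toFrac (ratField (D.U a s)) := by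
  simp [stateRow, toRow, rawRow]

theorem nodup_states : (ExplicitState.states D).Nodup :=
  (List.nodup_finRange _).map finPiFinEquiv.symm.injective

theorem mem_states (s : D.State) : s ∈ ExplicitState.states D :=
  List.mem_map.2 ⟨finPiFinEquiv s, List.mem_finRange _, finPiFinEquiv.symm_apply_apply s⟩

theorem maximal_map_finRange {n : ℕ} {q : Fin n → Frac} {u : Fin n → ℚ}
    (h : ∀ a, (q a).Valid ∧ (q a).val = u a) :
    maximal ((List.finRange n).map q) =
      (List.finRange n).map fun a => decide (∀ b, u b ≤ u a) := by
  rw [maximal, List.map_map]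
  congr 1
  funext a
  rw [Bool.eq_iff_iff]
  simp [Frac.le_iff (h _).1 (h _).1, (h _).2]

theorem totals_map_stateRow (s : D.State) (l : List D.State) :
    ∃ q : D.Action → Frac, totals (stateRow I s).2.2 (l.map (stateRow I)) =
        (List.finRange D.numActions).map q ∧
      ∀ a, (q a).Valid ∧ (q a).val = (l.map fun s' => D.P s' * D.U a s').sum := by
  -- The induction needs an arbitrary valid starting vector in place of zero.
  suffices h : ∀ z : D.Action → Frac, (∀ a, (z a).Valid) →
      ∃ q : D.Action → Frac, (l.map (stateRow I)).foldl (fun w r => addVec w (scale r.2.1 r.2.2))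
          ((List.finRange D.numActions).map z) = (List.finRange D.numActions).map q ∧
        ∀ a, (q a).Valid ∧
          (q a).val = (z a).val + (l.map fun s' => D.P s' * D.U a s').sum by
    obtain ⟨q, h₁, h₂⟩ := h (fun _ => Frac.zero) fun _ => Frac.valid_zero
    refine ⟨q, ?_, by simpa [Frac.val_zero] using h₂⟩
    rw [totals, stateRow_utilities, List.map_map]
    exact h₁
  induction l with
  | nil => exact fun z hz => ⟨z, rfl, fun a => ⟨hz a, by simp⟩⟩
  | cons t l ih =>
    intro z hz
    have hp := stateRow_prob I t
    have hu := fun a => toFrac_ratField (D.U a t)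
    obtain ⟨q, h₁, h₂⟩ := ih
      (fun a => (z a).add ((stateRow I t).2.1.mul (toFrac (ratField (D.U a t)))))
      fun a => (hz a).add (hp.1.mul (hu a).1)
    refine ⟨q, ?_, fun a => ⟨(h₂ a).1, ?_⟩⟩
    · rw [List.map_cons, List.foldl_cons, ← h₁, stateRow_utilities, scale, addVec, List.map_map,
        List.zip_map', List.map_map]
      rfl
    · rw [(h₂ a).2, Frac.val_add (hz a) (hp.1.mul (hu a).1), Frac.val_mul, hp.2, (hu a).2,
        List.map_cons, List.sum_cons, add_assoc]

/-- The states with the same signal as `s`. -/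
def fiberList (s : D.State) : List D.State :=
  (ExplicitState.states D).filter fun s' => decide (I.restrict s' = I.restrict s)

theorem sum_fiberList (s : D.State) (f : D.State → ℚ) :
    ((fiberList I s).map f).sum = ∑ s' ∈ D.fiber I (I.restrict s), f s' := by
  have h : (fiberList I s).Nodup := nodup_states.filter _
  rw [← List.sum_toFinset f h]
  congr 1
  ext s'
  simp [fiberList, StochasticDecisionProblem.fiber, mem_states]

theorem filter_map_stateRow (s : D.State) :
    (((ExplicitState.states D).map (stateRow I)).filter fun r =>
      decide (r.1 = (stateRow I s).1)) = (fiberList I s).map (stateRow I) := by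
  rw [List.filter_map, fiberList]
  congr 2
  funext s'
  simp [stateRow_fst_eq_iff]

theorem all_le_zero_iff (s : D.State) :
    (((fiberList I s).map (stateRow I)).all fun r => r.2.1.le Frac.zero) = true ↔
      ¬ D.Admissible I (I.restrict s) := by
  rw [StochasticDecisionProblem.Admissible, StochasticDecisionProblem.fiberProb,
    Finset.sum_pos_iff_of_nonneg fun s _ => D.P_nonneg s]
  simp [Frac.le_iff (stateRow_prob I _).1 Frac.valid_zero, (stateRow_prob I _).2, Frac.val_zero,
    fiberList, mem_states, StochasticDecisionProblem.fiber, ← imp_iff_not_or]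

theorem maximal_utilities (s : D.State) :
    maximal (stateRow I s).2.2 =
      (List.finRange D.numActions).map fun a => decide (∀ b, D.U b s ≤ D.U a s) := by
  rw [stateRow_utilities]
  exact maximal_map_finRange fun a => toFrac_ratField _

theorem checkNull_iff (rule : NullFiberRule) (s : D.State) :
    checkNull (stateRow I s).2.2 rule = true ↔ D.NullFiberCondition s rule := by
  cases rule
  · simp [checkNull, StochasticDecisionProblem.NullFiberCondition]
  · simp [checkNull, StochasticDecisionProblem.NullFiberCondition]
  · rw [checkNull, maximal_utilities]
    simp [StochasticDecisionProblem.NullFiberCondition, StochasticDecisionProblem.Opt,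
      Set.eq_univ_iff_forall]

/-- Admissibility makes the common denominator of the conditional expectations positive, so removing
it preserves every comparison. -/
theorem maximal_totals_eq_iff (s : D.State) (h : D.Admissible I (I.restrict s)) :
    maximal (totals (stateRow I s).2.2 ((fiberList I s).map (stateRow I))) =
      maximal (stateRow I s).2.2 ↔ D.OptStoch I (I.restrict s) = D.Opt s := by
  obtain ⟨q, h₁, h₂⟩ := totals_map_stateRow I s (fiberList I s)
  rw [h₁, maximal_map_finRange h₂, maximal_utilities, Set.ext_iff]
  simp only [List.map_inj_left, List.mem_finRange, forall_true_left, decide_eq_decide]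
  refine forall_congr' fun a => iff_congr (forall_congr' fun b => ?_) Iff.rfl
  rw [sum_fiberList, sum_fiberList, StochasticDecisionProblem.condUtility,
    StochasticDecisionProblem.condUtility, div_le_div_iff_of_pos_right h]

theorem check_map_stateRow (rule : NullFiberRule) :
    check rule ((ExplicitState.states D).map (stateRow I)) = true ↔
      D.StochasticallySufficient rule I := by
  rw [check, List.all_eq_true, List.forall_mem_map]
  constructor
  · intro h s
    have hs := h s (mem_states s)
    rw [checkRow, filter_map_stateRow] at hs
    split_ifs at hs with h'
    · rw [all_le_zero_iff] at h'
      exact ⟨fun h => absurd h h', fun _ => (checkNull_iff I rule s).1 hs⟩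
    · rw [all_le_zero_iff, not_not] at h'
      exact ⟨fun _ => (maximal_totals_eq_iff I s h').1 (of_decide_eq_true hs), fun h => absurd h' h⟩
  · intro h s _
    rw [checkRow, filter_map_stateRow]
    split_ifs with h'
    · rw [all_le_zero_iff] at h'
      exact (checkNull_iff I rule s).2 ((h s).2 h')
    · rw [all_le_zero_iff, not_not] at h'
      exact decide_eq_true ((maximal_totals_eq_iff I s h').2 ((h s).1 h'))

end

/-! ### The machine -/

/-- Push the token of the input symbol read last to the list on `main`, and read the next one. -/
def readSymbol : Fragment := op fun L q =>
  -- A set bit above the code of the token and the code of the list completes the code of the longer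
  -- list.
  let q' := .push .main (fun _ => .bit true) <| .pop .input (fun _ s => s) q
  .branch (fun v => v = some .blank) (pushWord L q' (code (token .blank))) <|
  .branch (fun v => v = some .comma) (pushWord L q' (code (token .comma))) <|
  .branch (fun v => v = some (.bit true)) (pushWord L q' (code (token (.bit true)))) <|
  .branch (fun v => v = some (.bit false)) (pushWord L q' (code (token (.bit false)))) <|
  pushWord L q' (code (token .bra))

theorem runs_readSymbol (s : Γ') (w : List Γ') (l : List (List Bool)) :
    Runs readSymbol (some s) (contents w [] (code l) [] [] []) w.head?
      (contents w.tail [] (code (token s :: l)) [] [] []) 1 :=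
  Runs.op fun _ _ => by
    rcases s with _ | (_ | _) | _ | _ | _ <;>
      simp [TM2.stepAux, stepAux_pushWord, code_cons, token]

/-- Read the input to a list of tokens on `main`, in reverse order. -/
def readInput : Fragment :=
  (op fun _ q => .pop .input (fun _ s => s) <| .push .main (fun _ => .bit false) q).seq <|
  loop Option.isSome readSymbol

theorem runs_readInput (w : List Γ') :
    Runs readInput none (contents w [] [] [] [] []) none
      (values (code (w.map token).reverse) []) (2 * w.length + 2) := by
  have key : ∀ (w : List Γ') (l : List (List Bool)), Runs (loop Option.isSome readSymbol)
      w.head? (contents w.tail [] (code l) [] [] []) none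
      (values (code ((w.map token).reverse ++ l)) []) (2 * w.length + 1) := by
    intro w
    induction w with
    | nil => exact fun l => Runs.loop_false rfl
    | cons s w ih =>
      intro l
      have := Runs.loop_true rfl (runs_readSymbol s w l) (ih (token s :: l))
      simpa using this.mono (by simp; omega)
  have h := key w []
  rw [List.append_nil] at h
  refine (Runs.seq (Runs.op fun _ _ => ?_) h).mono (by omega)
  simp [TM2.stepAux]
  rfl

/-- Move a truth value from `main` to the output stack. -/
def writeOutput : Fragment := op fun _ q =>
  .pop .main (fun _ s => s) <|
  .branch isTrue
    -- The code of `true` has two further symbols, which must go because only the output stack may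
    -- be nonempty at the end.
    (.push .output (fun _ => true) <| .pop .main (fun _ s => s) <| .pop .main (fun _ s => s) <|
      .load (fun _ => none) q)
    (.push .output (fun _ => false) <| .load (fun _ => none) q)

theorem runs_writeOutput (c : Bool) (v : Var) :
    Runs writeOutput v (values (code c) []) none (contents [] [c] [] [] [] []) 1 :=
  Runs.op fun _ _ => by
    cases c <;> simp [TM2.stepAux, isTrue, code, Enc.toTree, Tree.code]

theorem size_map_token_le (w : List Γ') : size (w.map token) ≤ 9 * w.length + 1 := by
  induction w with
  | nil => simp
  | cons s w ih =>
    have : size (token s) ≤ 8 := by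
      rcases s with _ | (_ | _) | _ | _ | _ <;> simp [token]
    simp
    omega

/-- A predicate is decidable in polynomial time if it is decided by a function of the sequence of
tokens of the encoding that is computed in polynomial time. -/
theorem polyTimeDecidable_of_polyTime {α : Type} {enc : α → List Γ'} {p : α → Prop}
    {f : List (List Bool) → Bool} (hf : PolyTime f)
    (h : ∀ x, f ((enc x).map token).reverse = true ↔ p x) : PolyTimeDecidable enc p := by
  obtain ⟨q, P, hq⟩ := hf
  refine ⟨_, h, ⟨{
    tm := toFinTM2 (readInput.seq <| q.seq writeOutput)
    inputAlphabet := Equiv.refl _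
    outputAlphabet := Equiv.refl _
    -- Reading takes `2 * ℓ + 2` steps, writing and halting one each, so 13 is generous; a list of
    -- `ℓ` tokens has size at most `9 * ℓ + 1`.
    time := 2 * .X + 13 + P.comp (9 * .X + 1)
    outputsFun := fun x => Nonempty.some ?_ }⟩⟩
  set w := enc x
  obtain ⟨v, hv⟩ := (hq (w.map token).reverse).2 none [] []
  simp only [List.append_nil] at hv
  have h₁ := outputs_of_runs <| (runs_readInput w).seq <| hv.seq (runs_writeOutput _ v)
  have h₂ := eval_mono P ((size_reverse _).le.trans (size_map_token_le w))
  obtain ⟨h₃⟩ := h₁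
  have e : initList (toFinTM2 (readInput.seq <| q.seq writeOutput)) (w.map id) =
      initList (toFinTM2 (readInput.seq <| q.seq writeOutput)) w :=
    congrArg _ (List.map_id w)
  refine ⟨⟨⟨h₃.steps, ?_⟩, h₃.steps_le_m.trans ?_⟩⟩
  · exact (congrArg (fun c => (flip bind _)^[h₃.steps] (some c)) e).trans h₃.evals_in_steps
  simp only [Polynomial.eval_add, Polynomial.eval_mul, Polynomial.eval_ofNat, Polynomial.eval_X,
    Polynomial.eval_comp, Polynomial.eval_one] at *
  omega

end StackMachine

theorem mainTheorem7 (r : NullFiberRule) :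
    PolyTimeDecidable ExplicitState.encode
      (fun x : StochasticSufficiencyInput => x.1.StochasticallySufficient r x.2) := by
  refine StackMachine.polyTimeDecidable_of_polyTime
    ((StackMachine.polyTime_check r).comp
      (StackMachine.polyTime_rows.comp StackMachine.polyTime_parse)) fun x => ?_
  rw [StackMachine.rows_parse_encode]
  exact StackMachine.check_map_stateRow x.2 r
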